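/- Let $n\ge 2$, $x_i=i/n$ for $i=1,\dots,n$, and let $f=(F(x_1),\dots,F(x_n))\in\mathbb R^n$ for an unknown real function $F$. One observes $Y=f+\xi$, where $\xi=(\xi_1,\dots,\xi_n)$ has independent centered components such that, for known numbers $\sigma,c\ge 0$, all $i$ and all $\lambda\in(-1/c,1/c)$ (with $1/0=+\infty$), $$\log\mathbb E\big[e^{\lambda\xi_i}\big]\le\frac{\lambda^2\sigma^2}{2(1-|\lambda|c)} .$$ Let $|\cdot|_2$ be the Euclidean norm on $\mathbb R^n$ and define the discrete trigonometric system by $\phi_0=(1/\sqrt n,\dots,1/\sqrt n)$ and, for $j\ge1$, $$\phi_{2j-1}=\sqrt{2/n}\,\big(\cos(2\pi jx_1),\dots,\cos(2\pi jx_n)\big),\qquad \phi_{2j}=\sqrt{2/n}\,\big(\sin(2\pi jx_1),\dots,\sin(2\pi jx_n)\big).$$ Let $\overline D\ge 0$ be an integer and $\mathcal M$ a nonempty family of subsets of $\{0,\dots,2\overline D\}$. For $m\in\mathcal M$ let $S_m$ be the linear span of the $\phi_j$, $j\in m$ (with $S_\varnothing=\{0\}$), $D_m=\dim S_m$, and let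 $\hat f_m$ be the orthogonal projection of $Y$ onto $S_m$. Let $(\Delta_m)_{m\in\mathcal M}$ be nonnegative numbers and $\Sigma=\sum_{m\in\mathcal M}e^{-\Delta_m}$. Given a penalty $\mathrm{pen}:\mathcal M\to\mathbb R_+$, let $\hat m$ be any (measurable) minimizer over $\mathcal M$ of $\mathrm{crit}(m)=|Y-\hat f_m|_2^2+\mathrm{pen}(m)$. Put $\kappa=18$. Let $a,b>0$ and assume that $2\overline D+1\le \sqrt n/(a\log n)$. If for some $K>1$ $$\mathrm{pen}(m)\ge K\kappa^2\Big(\sigma^2+\frac{4c(c+\sigma)(b+2)}{a}\Big)(D_m+\Delta_m)\qquad\text{for all } m\in\mathcal M,$$ then the quadratic risks below are finite and $$\mathbb E\big[|f-\hat f_{\hat m}|_2^2\big]\le C(K)\Big[\inf_{m\in\mathcal M}\Big(\mathbb E\big[|f-\hat f_m|_2^2\big]+\mathrm{pen}(m)\Big)+R\Big],$$ where $$C(K)=\frac{K(K^2+K-1)}{(K-1)^3},\qquad R=\kappa^2\Big(\sigma^2+\frac{4c(c+\sigma)(b+2)}{a}\Big)\Sigma+\frac{4(b+2)^2(c+\sigma)^2}{a^2(2\overline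 D+1)n^b}.$$ -/

import Mathlib

open MeasureTheory ProbabilityTheory

noncomputable section

namespace TrigSelection

/-- The design points `x_i = i / n`, `i = 1, …, n` (the index `i : Fin n` is shifted by one). -/
def design (n : ℕ) (i : Fin n) : ℝ := ((i : ℝ) + 1) / n

/-- The discrete trigonometric system: `φ_0 = (1/√n, …, 1/√n)` and, for `k ≥ 1`,
`φ_{2k-1} = √(2/n) (cos (2πk x_1), …, cos (2πk x_n))`,
`φ_{2k} = √(2/n) (sin (2πk x_1), …, sin (2πk x_n))`. -/
def trigVec (n j : ℕ) : EuclideanSpace ℝ (Fin n) :=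
  WithLp.toLp 2 fun i =>
    if j = 0 then 1 / √(n : ℝ)
    else if Odd j then
      √(2 / (n : ℝ)) * Real.cos (2 * Real.pi * (((j + 1) / 2 : ℕ) : ℝ) * design n i)
    else √(2 / (n : ℝ)) * Real.sin (2 * Real.pi * ((j / 2 : ℕ) : ℝ) * design n i)

/-- The model `S_m`, the linear span of the `φ_j`, `j ∈ m`. -/
def model (n : ℕ) (m : Finset ℕ) : Submodule ℝ (EuclideanSpace ℝ (Fin n)) :=
  Submodule.span ℝ (trigVec n '' (m : Set ℕ))

/-- The dimension `D_m` of `S_m`. -/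
def modelDim (n : ℕ) (m : Finset ℕ) : ℕ := Module.finrank ℝ (model n m)

/-- The vector `f = (F(x_1), …, F(x_n))`. -/
def signal (n : ℕ) (F : ℝ → ℝ) : EuclideanSpace ℝ (Fin n) :=
  WithLp.toLp 2 fun i => F (design n i)

/-- The observation `Y = f + ξ`. -/
def obs {Ω : Type*} {n : ℕ} (F : ℝ → ℝ) (ξ : Fin n → Ω → ℝ) (ω : Ω) :
    EuclideanSpace ℝ (Fin n) :=
  signal n F + WithLp.toLp 2 fun i => ξ i ω

/-- The least-squares estimator on `S_m`: the orthogonal projection of `y` onto `S_m`. -/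
def lse {n : ℕ} (m : Finset ℕ) (y : EuclideanSpace ℝ (Fin n)) : EuclideanSpace ℝ (Fin n) :=
  (model n m).starProjection y

/-- The penalized criterion `crit(m) = |y - Π_{S_m} y|² + pen(m)`. -/
def crit {n : ℕ} (pen : Finset ℕ → ℝ) (y : EuclideanSpace ℝ (Fin n)) (m : Finset ℕ) : ℝ :=
  ‖y - lse m y‖ ^ 2 + pen m

/-- The Bernstein-type condition: for all `l` in `(-1/c, 1/c)` (with `1/0 = +∞`), the Laplace
transform of `X` at `l` is finite and its logarithm is at most `l²σ² / (2(1 - |l|c))`. -/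
def BernsteinCondition {Ω : Type*} [MeasurableSpace Ω] (P : Measure Ω) (σ c : ℝ)
    (X : Ω → ℝ) : Prop :=
  ∀ l : ℝ, |l| * c < 1 →
    Integrable (fun ω => Real.exp (l * X ω)) P ∧
      Real.log (∫ ω, Real.exp (l * X ω) ∂P) ≤ l ^ 2 * σ ^ 2 / (2 * (1 - |l| * c))

/-- The numerical constant `κ`. -/
def kappa : ℝ := 18

/-- The constant `C(K)` of the oracle inequality. -/
def oracleConst (K : ℝ) : ℝ := K * (K ^ 2 + K - 1) / (K - 1) ^ 3

/-- The variance factor `σ² + 4c(c+σ)(b+2)/a`. -/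
def varFactor (σ c a b : ℝ) : ℝ := σ ^ 2 + 4 * c * (c + σ) * (b + 2) / a

/-- The remainder
`R = κ²(σ² + 4c(c+σ)(b+2)/a) Σ + 4(b+2)²(c+σ)² / (a²(2D+1)n^b)` with `Σ = ∑_{m ∈ M} e^{-Δ_m}`. -/
def remainder (n D : ℕ) (M : Finset (Finset ℕ)) (Δ : Finset ℕ → ℝ) (σ c a b : ℝ) : ℝ :=
  kappa ^ 2 * varFactor σ c a b * (∑ m ∈ M, Real.exp (-Δ m)) +
    4 * (b + 2) ^ 2 * (c + σ) ^ 2 / (a ^ 2 * (2 * (D : ℝ) + 1) * (n : ℝ) ^ b)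

end TrigSelection

end

/-! On the grid, two vectors of the trigonometric system are either orthogonal or parallel
(aliasing), so one orthonormal family with entries at most `√(2/n)` spans every model by
coordinates, with no restriction of `D` relative to `n`. In these coordinates the loss of a model is
its squared bias plus the noise energy on its coordinates, and minimality of the criterion becomes
an inequality between finite sums.

The noise enters through a variable `T` bounding, for all models at once, the excess of the energy
over `324 v (D_m + Δ_m)`, where `v` is the variance factor (`exists_excess`). On the event that all
noise coordinates are below a multiple of `log n`, the projected noise has small sup norm, because
each model has at most `2D+1 ≤ √n/(a log n)` coordinates of size `√(2/n)`. The Bernstein bound is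
then used only where it is sub-Gaussian, and averaging the Laplace transform over a convex set gives
`E exp(‖Πξ‖²/(80v)) ≤ 2^{D_m}` on that event (`lintegral_exp_norm_sq_le`). Off the event, crude
exponential tails give the term in `n^{-b}`.

The oracle inequality with the stated constant needs two arguments (`integral_loss_le`). For `K ≤
4`, Young's inequality with a tuned weight produces `oracleConst K` but multiplies `T` by `K`. For
`K ≥ 4` that factor is too large; the selected model is compared instead with a fixed reference
model, the smallest one with bias of the order of the target. The linear noise terms then involve
deterministic models and have mean zero, the fluctuations are paid by the penalty, and the leading
constant is `1 + 2/K ≤ oracleConst K`. -/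

namespace TrigSelection

/-! ### Orthonormalizing a family of pairwise orthogonal or parallel vectors -/

section OrthogonalOrParallel

variable {E : Type*} [NormedAddCommGroup E] [InnerProductSpace ℝ E]

/-- The unit vectors spanning the lines of a family whose members are pairwise orthogonal or
parallel. -/
lemma exists_orthonormal_of_orthogonal_or_parallel (φ : ℕ → E)
    (h : ∀ i j, inner ℝ (φ i) (φ j) = 0 ∨ ∃ a : ℝ, φ i = a • φ j) (J : Finset ℕ) :
    ∃ e : Finset E, e.card ≤ J.card ∧ Orthonormal ℝ (fun x : e => (x : E)) ∧
      (∀ x ∈ e, ∃ j ∈ J, φ j ≠ 0 ∧ x = ‖φ j‖⁻¹ • φ j) ∧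
      ∀ j ∈ J, φ j ≠ 0 → ∃ x ∈ e, ∃ a : ℝ, φ j = a • x := by
  classical
  induction J using Finset.induction_on with
  | empty => exact ⟨∅, by simp, by simp, by simp, by simp⟩
  | insert j J hj ih =>
    obtain ⟨e, hcard, hon, hmem, hspan⟩ := ih
    by_cases hpar : φ j = 0 ∨ ∃ x ∈ e, ∃ a : ℝ, φ j = a • x
    · refine ⟨e, hcard.trans (Finset.card_le_card (Finset.subset_insert _ _)), hon, ?_, ?_⟩
      · intro x hx
        obtain ⟨i, hi, h1⟩ := hmem x hx
        exact ⟨i, Finset.mem_insert_of_mem hi, h1⟩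
      · intro i hi hi0
        rcases Finset.mem_insert.1 hi with rfl | hi
        · exact hpar.resolve_left hi0
        · exact hspan i hi hi0
    · push Not at hpar
      obtain ⟨hj0, hpar⟩ := hpar
      have horth : ∀ x ∈ e, inner ℝ (φ j) x = 0 := fun x hx => by
        obtain ⟨i, hi, hi0, rfl⟩ := hmem x hx
        rcases h j i with h1 | ⟨a, h1⟩
        · rw [inner_smul_right, h1, mul_zero]
        · refine absurd ?_ (hpar _ hx (a * ‖φ i‖))
          rw [smul_smul, mul_assoc, mul_inv_cancel₀ (norm_ne_zero_iff.2 hi0), mul_one, h1]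
      have hnorm : ‖‖φ j‖⁻¹ • φ j‖ = 1 := by
        rw [norm_smul, norm_inv, norm_norm, inv_mul_cancel₀ (norm_ne_zero_iff.2 hj0)]
      refine ⟨insert (‖φ j‖⁻¹ • φ j) e, ?_, ?_, ?_, ?_⟩
      · rw [Finset.card_insert_of_notMem hj]
        exact (Finset.card_insert_le _ _).trans (by lia)
      · refine ⟨?_, ?_⟩
        · rintro ⟨x, hx⟩
          rcases Finset.mem_insert.1 hx with rfl | hx
          · exact hnorm
          · exact hon.1 ⟨x, hx⟩
        · rintro ⟨x, hx⟩ ⟨y, hy⟩ hxy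
          have hxy' : x ≠ y := fun h => hxy (Subtype.ext h)
          rcases Finset.mem_insert.1 hx with rfl | hx <;> rcases Finset.mem_insert.1 hy with rfl | hy
          · exact absurd rfl hxy'
          · simp [inner_smul_left, horth y hy]
          · simp [inner_smul_right, real_inner_comm (φ j) x, horth x hx]
          · exact hon.2 (i := ⟨x, hx⟩) (j := ⟨y, hy⟩) (fun h => hxy' (congrArg Subtype.val h))
      · intro x hx
        rcases Finset.mem_insert.1 hx with rfl | hx
        · exact ⟨j, Finset.mem_insert_self _ _, hj0, rfl⟩
        · obtain ⟨i, hi, h1⟩ := hmem x hx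
          exact ⟨i, Finset.mem_insert_of_mem hi, h1⟩
      · intro i hi hi0
        rcases Finset.mem_insert.1 hi with rfl | hi
        · refine ⟨_, Finset.mem_insert_self _ _, ‖φ i‖, ?_⟩
          rw [smul_smul, mul_inv_cancel₀ (norm_ne_zero_iff.2 hi0), one_smul]
        · obtain ⟨x, hx, h1⟩ := hspan i hi hi0
          exact ⟨x, Finset.mem_insert_of_mem hx, h1⟩

/-- Every span of members of such a family is spanned by some of the unit vectors. -/
lemma exists_span_eq_of_orthogonal_or_parallel (φ : ℕ → E) {J : Finset ℕ} {e : Finset E}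
    (hspan : ∀ j ∈ J, φ j ≠ 0 → ∃ x ∈ e, ∃ a : ℝ, φ j = a • x) {m : Finset ℕ} (hm : m ⊆ J) :
    ∃ s : Finset e, Submodule.span ℝ (φ '' (m : Set ℕ)) =
      Submodule.span ℝ ((fun x : e => (x : E)) '' (s : Set e)) := by
  classical
  refine ⟨Finset.univ.filter fun x => ∃ j ∈ m, φ j ≠ 0 ∧ ∃ a : ℝ, φ j = a • (x : E), ?_⟩
  apply le_antisymm
  · rw [Submodule.span_le]
    rintro _ ⟨j, hj, rfl⟩
    by_cases hj0 : φ j = 0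
    · rw [hj0]; exact Submodule.zero_mem _
    · obtain ⟨x, hx, a, ha⟩ := hspan j (hm hj) hj0
      rw [ha]
      refine Submodule.smul_mem _ _ (Submodule.subset_span ⟨⟨x, hx⟩, ?_, rfl⟩)
      simp only [Finset.coe_filter, Finset.mem_univ, true_and, Set.mem_ofPred_eq]
      exact ⟨j, hj, hj0, a, ha⟩
  · rw [Submodule.span_le]
    rintro _ ⟨x, hx, rfl⟩
    simp only [Finset.coe_filter, Finset.mem_univ, true_and, Set.mem_ofPred_eq] at hx
    obtain ⟨j, hj, hj0, a, ha⟩ := hx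
    have ha0 : a ≠ 0 := by rintro rfl; exact hj0 (by rw [ha, zero_smul])
    have : (x : E) = a⁻¹ • φ j := by rw [ha, smul_smul, inv_mul_cancel₀ ha0, one_smul]
    change (x : E) ∈ _
    rw [this]
    exact Submodule.smul_mem _ _ (Submodule.subset_span ⟨j, hj, rfl⟩)

end OrthogonalOrParallel

/-! ### Aliasing and orthogonality of the discrete trigonometric system -/

section Trigonometric

/-- A geometric sum over an `n`-th root of unity, which equals `1` exactly when `n` divides `k`. All
discrete orthogonality and aliasing relations below come from it. -/
lemma sum_exp_design {n : ℕ} (hn : 0 < n) (k : ℤ) :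
    ∑ i : Fin n, Complex.exp ((2 * Real.pi * k * design n i : ℝ) * Complex.I) =
      if (n : ℤ) ∣ k then (n : ℂ) else 0 := by
  have hnC : (n : ℂ) ≠ 0 := by exact_mod_cast hn.ne'
  set ζ : ℂ := Complex.exp (2 * Real.pi * Complex.I * (k / n)) with hζ
  have hterm : ∀ i : Fin n, Complex.exp ((2 * Real.pi * k * design n i : ℝ) * Complex.I) =
      ζ * ζ ^ (i : ℕ) := fun i => by
    rw [← pow_succ', hζ, ← Complex.exp_nat_mul]
    congr 1
    simp only [design]
    push_cast
    ring
  simp only [hterm]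
  rw [← Finset.mul_sum, Fin.sum_univ_eq_sum_range (fun i => ζ ^ i)]
  have hone : ζ = 1 ↔ (n : ℤ) ∣ k := by
    rw [hζ, Complex.exp_eq_one_iff]
    constructor
    · rintro ⟨q, hq⟩
      have h1 : (2 * Real.pi * Complex.I) * ((k : ℂ) / n) = (2 * Real.pi * Complex.I) * q := by
        rw [hq]; ring
      have h2 := mul_left_cancel₀ Complex.two_pi_I_ne_zero h1
      rw [div_eq_iff hnC] at h2
      refine ⟨q, ?_⟩
      rw [mul_comm]
      exact_mod_cast h2
    · rintro ⟨q, rfl⟩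
      refine ⟨q, ?_⟩
      push_cast
      field_simp
  have hpow : ζ ^ n = 1 := by
    rw [hζ, ← Complex.exp_nat_mul, Complex.exp_eq_one_iff]
    exact ⟨k, by field_simp⟩
  split_ifs with h
  · rw [hone.2 h]; simp
  · have : ζ ≠ 1 := fun h' => h (hone.1 h')
    rw [geom_sum_eq this, hpow]; simp

lemma sum_cos_design {n : ℕ} (hn : 0 < n) (k : ℤ) :
    ∑ i : Fin n, Real.cos (2 * Real.pi * k * design n i) = if (n : ℤ) ∣ k then (n : ℝ) else 0 := by
  have h := congrArg Complex.re (sum_exp_design hn k)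
  simp only [Complex.re_sum, Complex.exp_ofReal_mul_I_re] at h
  rw [h]; split_ifs <;> simp

lemma sum_sin_design {n : ℕ} (hn : 0 < n) (k : ℤ) :
    ∑ i : Fin n, Real.sin (2 * Real.pi * k * design n i) = 0 := by
  have h := congrArg Complex.im (sum_exp_design hn k)
  simp only [Complex.im_sum, Complex.exp_ofReal_mul_I_im] at h
  rw [h]; split_ifs <;> simp

/-- The vector of the values of `cos (2πk ·)` at the design points. -/
noncomputable def cosVec (n : ℕ) (k : ℤ) : EuclideanSpace ℝ (Fin n) :=
  WithLp.toLp 2 fun i => Real.cos (2 * Real.pi * k * design n i)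

/-- The vector of the values of `sin (2πk ·)` at the design points. -/
noncomputable def sinVec (n : ℕ) (k : ℤ) : EuclideanSpace ℝ (Fin n) :=
  WithLp.toLp 2 fun i => Real.sin (2 * Real.pi * k * design n i)

lemma inner_cosVec {n : ℕ} (hn : 0 < n) (k l : ℤ) :
    inner ℝ (cosVec n k) (cosVec n l) =
      ((if (n : ℤ) ∣ k - l then (n : ℝ) else 0) + if (n : ℤ) ∣ k + l then (n : ℝ) else 0) / 2 := by
  rw [← sum_cos_design hn, ← sum_cos_design hn, ← Finset.sum_add_distrib, Finset.sum_div]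
  simp only [cosVec, PiLp.inner_apply, RCLike.inner_apply, conj_trivial]
  refine Finset.sum_congr rfl fun i _ => ?_
  have e1 : 2 * Real.pi * ((k - l : ℤ) : ℝ) * design n i =
    2 * Real.pi * k * design n i - 2 * Real.pi * l * design n i := by push_cast; ring
  have e2 : 2 * Real.pi * ((k + l : ℤ) : ℝ) * design n i =
    2 * Real.pi * k * design n i + 2 * Real.pi * l * design n i := by push_cast; ring
  rw [e1, e2, Real.cos_sub, Real.cos_add]; ring

lemma inner_sinVec {n : ℕ} (hn : 0 < n) (k l : ℤ) :
    inner ℝ (sinVec n k) (sinVec n l) =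
      ((if (n : ℤ) ∣ k - l then (n : ℝ) else 0) - if (n : ℤ) ∣ k + l then (n : ℝ) else 0) / 2 := by
  rw [← sum_cos_design hn, ← sum_cos_design hn, ← Finset.sum_sub_distrib, Finset.sum_div]
  simp only [sinVec, PiLp.inner_apply, RCLike.inner_apply, conj_trivial]
  refine Finset.sum_congr rfl fun i _ => ?_
  have e1 : 2 * Real.pi * ((k - l : ℤ) : ℝ) * design n i =
    2 * Real.pi * k * design n i - 2 * Real.pi * l * design n i := by push_cast; ring
  have e2 : 2 * Real.pi * ((k + l : ℤ) : ℝ) * design n i =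
    2 * Real.pi * k * design n i + 2 * Real.pi * l * design n i := by push_cast; ring
  rw [e1, e2, Real.cos_sub, Real.cos_add]; ring

lemma inner_cosVec_sinVec {n : ℕ} (hn : 0 < n) (k l : ℤ) :
    inner ℝ (cosVec n k) (sinVec n l) = 0 := by
  have h : (∑ i : Fin n, Real.sin (2 * Real.pi * ((k + l : ℤ) : ℝ) * design n i) -
      ∑ i : Fin n, Real.sin (2 * Real.pi * ((k - l : ℤ) : ℝ) * design n i)) / 2 = 0 := by
    rw [sum_sin_design hn, sum_sin_design hn]; simp
  rw [← h, ← Finset.sum_sub_distrib, Finset.sum_div]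
  simp only [cosVec, sinVec, PiLp.inner_apply, RCLike.inner_apply, conj_trivial]
  refine Finset.sum_congr rfl fun i _ => ?_
  have e1 : 2 * Real.pi * ((k - l : ℤ) : ℝ) * design n i =
    2 * Real.pi * k * design n i - 2 * Real.pi * l * design n i := by push_cast; ring
  have e2 : 2 * Real.pi * ((k + l : ℤ) : ℝ) * design n i =
    2 * Real.pi * k * design n i + 2 * Real.pi * l * design n i := by push_cast; ring
  rw [e1, e2, Real.sin_sub, Real.sin_add]; ring

lemma cosVec_neg (n : ℕ) (k : ℤ) : cosVec n (-k) = cosVec n k := by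
  ext i
  simp only [cosVec]
  rw [← Real.cos_neg]
  push_cast
  ring_nf

lemma sinVec_neg (n : ℕ) (k : ℤ) : sinVec n (-k) = -sinVec n k := by
  ext i
  simp only [sinVec, PiLp.neg_apply]
  rw [← Real.sin_neg]
  push_cast
  ring_nf

lemma two_pi_mul_design {n : ℕ} (hn : 0 < n) (i : Fin n) {k l : ℤ} {q : ℤ} (h : k - l = n * q) :
    2 * Real.pi * k * design n i =
      2 * Real.pi * l * design n i + ((q * (i + 1) : ℤ) : ℝ) * (2 * Real.pi) := by
  have hk : (k : ℝ) = l + n * q := by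
    have : k = l + n * q := by lia
    exact_mod_cast this
  have : (n : ℝ) ≠ 0 := by positivity
  rw [hk]
  simp only [design]
  push_cast
  field_simp

lemma cosVec_eq_of_dvd {n : ℕ} (hn : 0 < n) {k l : ℤ} (h : (n : ℤ) ∣ k - l) :
    cosVec n k = cosVec n l := by
  obtain ⟨q, hq⟩ := h
  ext i
  simp only [cosVec]
  rw [two_pi_mul_design hn i hq, Real.cos_add_int_mul_two_pi]

lemma sinVec_eq_of_dvd {n : ℕ} (hn : 0 < n) {k l : ℤ} (h : (n : ℤ) ∣ k - l) :
    sinVec n k = sinVec n l := by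
  obtain ⟨q, hq⟩ := h
  ext i
  simp only [sinVec]
  rw [two_pi_mul_design hn i hq, Real.sin_add_int_mul_two_pi]

/-- The sine vector vanishes when `n` divides twice its frequency; every other vector has norm at
least `1`. Normalization therefore never enlarges the entries, and the bound `√(2/n)` survives. -/
lemma trigVec_cases {n : ℕ} (hn : 0 < n) (j : ℕ) : ∃ a : ℝ, ∃ k : ℤ, 0 < a ∧ a ≤ √(2 / n) ∧
    (trigVec n j = a • cosVec n k ∨ trigVec n j = a • sinVec n k) ∧
    (trigVec n j ≠ 0 → 1 ≤ ‖trigVec n j‖) := by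
  have hn0 : (0 : ℝ) < n := by exact_mod_cast hn
  have hsq : √(2 / (n : ℝ)) ^ 2 = 2 / n := Real.sq_sqrt (by positivity)
  have hnorm : ∀ (a : ℝ) (x : EuclideanSpace ℝ (Fin n)), 1 ≤ a ^ 2 * inner ℝ x x → 1 ≤ ‖a • x‖ :=
    fun a x h => by
      rw [real_inner_self_eq_norm_sq, ← sq_abs, ← mul_pow, ← Real.norm_eq_abs, ← norm_smul] at h
      exact (one_le_sq_iff₀ (norm_nonneg _)).1 h
  by_cases hj : j = 0
  · have e : trigVec n j = (1 / √(n : ℝ)) • cosVec n 0 := by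
      ext i; simp [trigVec, cosVec, hj]
    refine ⟨1 / √(n : ℝ), 0, by positivity, ?_, Or.inl e, fun _ => ?_⟩
    · rw [← Real.sqrt_one, ← Real.sqrt_div zero_le_one]
      exact Real.sqrt_le_sqrt (by gcongr; norm_num)
    · rw [e]
      refine hnorm _ _ ?_
      rw [inner_cosVec hn]
      simp [hn0.ne']
  · by_cases hodd : Odd j
    · have e : trigVec n j = √(2 / (n : ℝ)) • cosVec n ((j + 1) / 2 : ℕ) := by
        ext i; simp [trigVec, cosVec, hj, hodd, -Int.natCast_ediv]
      refine ⟨_, _, by positivity, le_rfl, Or.inl e, fun _ => ?_⟩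
      rw [e]
      refine hnorm _ _ ?_
      rw [inner_cosVec hn, hsq, sub_self]
      simp only [dvd_zero, if_true]
      have : (2 / (n : ℝ)) * (n / 2) = 1 := by field_simp
      split_ifs
      · have : (2 / (n : ℝ)) * ((n + n) / 2) = 2 := by field_simp; norm_num
        linarith
      · rw [add_zero]; linarith
    · have e : trigVec n j = √(2 / (n : ℝ)) • sinVec n (j / 2 : ℕ) := by
        ext i; simp [trigVec, sinVec, hj, hodd, -Int.natCast_ediv]
      refine ⟨_, _, by positivity, le_rfl, Or.inr e, fun h0 => ?_⟩
      have hin := inner_sinVec hn ((j / 2 : ℕ) : ℤ) ((j / 2 : ℕ) : ℤ)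
      rw [sub_self] at hin
      simp only [dvd_zero, if_true] at hin
      rw [e] at h0 ⊢
      refine hnorm _ _ ?_
      rw [hsq, hin]
      split_ifs at hin ⊢
      · refine absurd ?_ h0
        rw [sub_self, zero_div, inner_self_eq_zero] at hin
        rw [hin, smul_zero]
      · have : (2 / (n : ℝ)) * ((n - 0) / 2) = 1 := by field_simp; norm_num
        linarith

/-- Two cosines, or two sines, have nonzero inner product only if their frequencies agree modulo `n`
up to sign, and then they sample the same function up to a scalar. -/
lemma inner_trigVec_eq_zero_or_parallel {n : ℕ} (hn : 0 < n) (i j : ℕ) :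
    inner ℝ (trigVec n i) (trigVec n j) = 0 ∨ ∃ a : ℝ, trigVec n i = a • trigVec n j := by
  obtain ⟨a, k, -, -, ha, -⟩ := trigVec_cases hn i
  obtain ⟨b, l, hb, -, hb', -⟩ := trigVec_cases hn j
  have hscale : ∀ x : EuclideanSpace ℝ (Fin n), a • x = (a / b) • b • x := fun x => by
    rw [smul_smul, div_mul_cancel₀ _ hb.ne']
  rcases ha with ha | ha <;> rcases hb' with hb' | hb' <;> rw [ha, hb']
  · by_cases h1 : (n : ℤ) ∣ k - l
    · exact Or.inr ⟨a / b, by rw [cosVec_eq_of_dvd hn h1, hscale]⟩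
    · by_cases h2 : (n : ℤ) ∣ k + l
      · refine Or.inr ⟨a / b, ?_⟩
        rw [cosVec_eq_of_dvd hn (l := -l) (by simpa using h2), cosVec_neg, hscale]
      · left; simp [inner_smul_left, inner_smul_right, inner_cosVec hn, h1, h2]
  · left; simp [inner_smul_left, inner_smul_right, inner_cosVec_sinVec hn]
  · left
    rw [real_inner_comm]
    simp [inner_smul_left, inner_smul_right, inner_cosVec_sinVec hn]
  · by_cases h1 : (n : ℤ) ∣ k - l
    · exact Or.inr ⟨a / b, by rw [sinVec_eq_of_dvd hn h1, hscale]⟩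
    · by_cases h2 : (n : ℤ) ∣ k + l
      · refine Or.inr ⟨-(a / b), ?_⟩
        rw [sinVec_eq_of_dvd hn (l := -l) (by simpa using h2), sinVec_neg, hscale, neg_smul,
          smul_neg, smul_neg]
      · left; simp [inner_smul_left, inner_smul_right, inner_sinVec hn, h1, h2]

lemma abs_trigVec_le {n : ℕ} (hn : 0 < n) (j : ℕ) (i : Fin n) : |trigVec n j i| ≤ √(2 / n) := by
  obtain ⟨a, k, ha0, ha1, ha, -⟩ := trigVec_cases hn j
  refine le_trans ?_ ha1
  rcases ha with ha | ha <;> rw [ha, PiLp.smul_apply, smul_eq_mul, abs_mul, abs_of_pos ha0]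
  · exact mul_le_of_le_one_right ha0.le (Real.abs_cos_le_one _)
  · exact mul_le_of_le_one_right ha0.le (Real.abs_sin_le_one _)

/-- An orthonormal family with small entries such that every trigonometric model is spanned by some
of its members. -/
lemma exists_trigBasis {n : ℕ} (hn : 0 < n) (N : ℕ) :
    ∃ e : Finset (EuclideanSpace ℝ (Fin n)), e.card ≤ N ∧ e.card ≤ n ∧
      Orthonormal ℝ (fun x : e => (x : EuclideanSpace ℝ (Fin n))) ∧
      (∀ x ∈ e, ∀ i, |x i| ≤ √(2 / n)) ∧
      ∀ m ⊆ Finset.range N, ∃ s : Finset e, model n m =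
        Submodule.span ℝ ((fun x : e => (x : EuclideanSpace ℝ (Fin n))) '' (s : Set e)) := by
  obtain ⟨e, hcard, hon, hmem, hspan⟩ := exists_orthonormal_of_orthogonal_or_parallel (trigVec n)
    (inner_trigVec_eq_zero_or_parallel hn) (Finset.range N)
  refine ⟨e, by simpa using hcard, ?_, hon, ?_, fun m hm =>
    exists_span_eq_of_orthogonal_or_parallel (trigVec n) hspan hm⟩
  · simpa using hon.linearIndependent.fintype_card_le_finrank
  · intro x hx i
    obtain ⟨j, -, hj0, rfl⟩ := hmem x hx
    obtain ⟨-, -, -, -, -, h1⟩ := trigVec_cases hn j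
    rw [PiLp.smul_apply, smul_eq_mul, abs_mul, abs_inv, abs_norm]
    exact (mul_le_of_le_one_left (abs_nonneg _) (inv_le_one_of_one_le₀ (h1 hj0))).trans
      (abs_trigVec_le hn j i)

end Trigonometric

/-! ### Deterministic comparison of the selected model with a competitor -/

section Coordinates

variable {ι : Type*} [Fintype ι] [DecidableEq ι]

/-- The squared bias of the coordinate model `s`; `r` is the energy outside all coordinates. -/
noncomputable def bias (r : ℝ) (θ : ι → ℝ) (s : Finset ι) : ℝ := r + ∑ k ∈ sᶜ, θ k ^ 2

/-- The energy of the noise in the coordinate model `s`. -/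
noncomputable def energy {ι : Type*} (x : ι → ℝ) (s : Finset ι) : ℝ := ∑ k ∈ s, x k ^ 2

lemma sum_eq_ite (s : Finset ι) (g : ι → ℝ) : ∑ k ∈ s, g k = ∑ k, if k ∈ s then g k else 0 := by
  simp

lemma sum_compl_eq_ite (s : Finset ι) (g : ι → ℝ) :
    ∑ k ∈ sᶜ, g k = ∑ k, if k ∈ s then 0 else g k := by
  rw [sum_eq_ite]
  exact Finset.sum_congr rfl fun k _ => by by_cases h : k ∈ s <;> simp [h]

lemma energy_nonneg {ι : Type*} (x : ι → ℝ) (s : Finset ι) : 0 ≤ energy x s :=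
  Finset.sum_nonneg fun _ _ => sq_nonneg _

lemma bias_nonneg {r : ℝ} (hr : 0 ≤ r) (θ : ι → ℝ) (s : Finset ι) : 0 ≤ bias r θ s :=
  add_nonneg hr (Finset.sum_nonneg fun _ _ => sq_nonneg _)

lemma loss_le_of_crit_le {r p p' : ℝ} {θ x : ι → ℝ} {s s' : Finset ι}
    (h : -∑ k ∈ s', (θ k + x k) ^ 2 + p' ≤ -∑ k ∈ s, (θ k + x k) ^ 2 + p) :
    bias r θ s' + energy x s' ≤ bias r θ s + p - p' + 2 * energy x s' - energy x s +
      (2 * ∑ k ∈ s', θ k * x k - 2 * ∑ k ∈ s, θ k * x k) := by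
  have e : ∀ t : Finset ι, ∑ k ∈ t, (θ k + x k) ^ 2 =
      ∑ k ∈ t, θ k ^ 2 + 2 * ∑ k ∈ t, θ k * x k + ∑ k ∈ t, x k ^ 2 := fun t => by
    rw [Finset.mul_sum, ← Finset.sum_add_distrib, ← Finset.sum_add_distrib]
    exact Finset.sum_congr rfl fun k _ => by ring
  have h1 := Finset.sum_add_sum_compl s fun k => θ k ^ 2
  have h2 := Finset.sum_add_sum_compl s' fun k => θ k ^ 2
  rw [e, e] at h
  simp only [bias, energy]
  linarith

/-- The left side is `2⟨x, u⟩ - energy x s`, with `u` the estimator on `s'` minus the projection of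
the signal on `s`. Young's inequality with weight `K` splits the product, and `‖u‖²` is at most `1 +
t` times the loss of `s'` plus `1 + 1/t` times the bias of `s`. The check is done coordinate by
coordinate. -/
lemma cross_le_mul_loss {r K t : ℝ} (hr : 0 ≤ r) (hK : 1 < K) (ht : 0 < t) (θ x : ι → ℝ)
    (s s' : Finset ι) :
    2 * energy x s' - energy x s + (2 * ∑ k ∈ s', θ k * x k - 2 * ∑ k ∈ s, θ k * x k) ≤
      (1 + t) / K * (bias r θ s' + energy x s') + (1 + 1 / t) / K * bias r θ s +
        K * energy x s + K * energy x s' := by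
  have hK0 : 0 < K := by linarith
  have h1 : 0 ≤ (1 + t) / K * r := by positivity
  have h2 : 0 ≤ (1 + 1 / t) / K * r := by positivity
  suffices h : 2 * energy x s' - energy x s + (2 * ∑ k ∈ s', θ k * x k - 2 * ∑ k ∈ s, θ k * x k) ≤
      (1 + t) / K * (∑ k ∈ s'ᶜ, θ k ^ 2 + energy x s') + (1 + 1 / t) / K * ∑ k ∈ sᶜ, θ k ^ 2 +
        K * energy x s + K * energy x s' by
    simp only [bias]; nlinarith
  simp only [energy, sum_compl_eq_ite, sum_eq_ite s, sum_eq_ite s', Finset.mul_sum,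
    ← Finset.sum_add_distrib, ← Finset.sum_sub_distrib]
  refine Finset.sum_le_sum fun k _ => ?_
  have amgm : ∀ y z : ℝ, 2 * (y * z) ≤ y ^ 2 / K + K * z ^ 2 := fun y z => by
    have : y ^ 2 / K + K * z ^ 2 - 2 * (y * z) = (y - K * z) ^ 2 / K := by field_simp; ring
    have : 0 ≤ (y - K * z) ^ 2 / K := by positivity
    linarith
  have e1 : (1 + t) / K = 1 / K + t / K := by ring
  have htx : ∀ y : ℝ, 0 ≤ t / K * y ^ 2 := fun y => by positivity
  have hix : ∀ y : ℝ, 0 ≤ 1 / K * y ^ 2 := fun y => by positivity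
  have hpq : 0 ≤ (1 + 1 / t) / K * θ k ^ 2 := by positivity
  have hKx : x k ^ 2 ≤ K * x k ^ 2 := by nlinarith [sq_nonneg (x k)]
  have hx := sq_nonneg (x k)
  by_cases hs : k ∈ s <;> by_cases hs' : k ∈ s' <;> simp only [hs, hs', if_true, if_false]
  · rw [e1]; nlinarith [htx (x k), hix (x k)]
  · rw [e1]
    have := amgm (θ k) (-x k)
    have e : θ k ^ 2 / K = 1 / K * θ k ^ 2 := by ring
    nlinarith [htx (θ k), hix (θ k)]
  · have := amgm (θ k + x k) (x k)
    have : (θ k + x k) ^ 2 / K ≤ (1 + t) / K * x k ^ 2 + (1 + 1 / t) / K * θ k ^ 2 := by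
      have : (1 + t) / K * x k ^ 2 + (1 + 1 / t) / K * θ k ^ 2 - (θ k + x k) ^ 2 / K =
        (t * x k - θ k) ^ 2 / (t * K) := by field_simp; ring
      have : 0 ≤ (t * x k - θ k) ^ 2 / (t * K) := by positivity
      linarith
    nlinarith
  · rw [e1]; nlinarith [htx (θ k), hix (θ k)]

lemma loss_le_of_small {r p p' K T : ℝ} (hr : 0 ≤ r) (hK : 1 < K) {θ x : ι → ℝ} {s s' : Finset ι}
    (h : -∑ k ∈ s', (θ k + x k) ^ 2 + p' ≤ -∑ k ∈ s, (θ k + x k) ^ 2 + p)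
    (hT : K * energy x s' ≤ p' + K * T) :
    bias r θ s' + energy x s' ≤ oracleConst K * bias r θ s +
      K ^ 2 / (K - 1) ^ 2 * (p + K * energy x s + K * T) := by
  have hK1 : 0 < K - 1 := by linarith
  have hK0 : 0 < K := by linarith
  have h1 := loss_le_of_crit_le (r := r) h
  -- With `t = (K-1)/K` the factor `(1+t)/K` is `1 - (K-1)²/K²`, so absorbing the loss leaves the
  -- factor `(K-1)²/K²`; dividing by it turns the bias coefficient into exactly `oracleConst K`.
  have h2 := cross_le_mul_loss hr hK (div_pos hK1 hK0) θ x s s'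
  have e1 : (1 + (K - 1) / K) / K = 1 - (K - 1) ^ 2 / K ^ 2 := by field_simp; ring
  have e2 : (1 + 1 / ((K - 1) / K)) / K = (K ^ 2 + K - 1) / (K * (K - 1)) - 1 := by
    field_simp; ring
  rw [e1, e2] at h2
  have h3 : (K - 1) ^ 2 / K ^ 2 * (bias r θ s' + energy x s') ≤
      (K ^ 2 + K - 1) / (K * (K - 1)) * bias r θ s + (p + K * energy x s + K * T) := by
    linarith
  have hpos : 0 < K ^ 2 / (K - 1) ^ 2 := by positivity
  have h4 := mul_le_mul_of_nonneg_left h3 hpos.le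
  have e3 : K ^ 2 / (K - 1) ^ 2 * ((K - 1) ^ 2 / K ^ 2 * (bias r θ s' + energy x s')) =
      bias r θ s' + energy x s' := by field_simp
  have e4 : K ^ 2 / (K - 1) ^ 2 * ((K ^ 2 + K - 1) / (K * (K - 1)) * bias r θ s +
      (p + K * energy x s + K * T)) = oracleConst K * bias r θ s +
      K ^ 2 / (K - 1) ^ 2 * (p + K * energy x s + K * T) := by
    unfold oracleConst; field_simp
  linarith

/-- The noise terms that remain when a model with small bias is compared with the reference
model `s₀`. -/
noncomputable def driftBound (c q : ℝ) (θ x : ι → ℝ) (s₀ : Finset ι) : ℝ :=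
  1 / c * ∑ k ∈ s₀ᶜ, θ k ^ 2 * x k ^ 2 + q / (c * s₀.card) * energy x s₀

lemma driftBound_nonneg {c q : ℝ} (hc : 0 < c) (hq : 0 ≤ q) (θ x : ι → ℝ) (s₀ : Finset ι) :
    0 ≤ driftBound c q θ x s₀ := by
  have := energy_nonneg x s₀
  have : 0 ≤ ∑ k ∈ s₀ᶜ, θ k ^ 2 * x k ^ 2 := Finset.sum_nonneg fun _ _ => by positivity
  unfold driftBound
  positivity

/-- Each coordinate gained by `s'` costs `c` plus a quadratic term in the noise. The coordinates of
`s₀` that `s'` drops carry signal energy at most the bias of `s'`, hence at most `q`. What remains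
random depends on `s₀` only, not on the selected `s'`. -/
lemma cross_le_driftBound {r c q : ℝ} (hr : 0 ≤ r) (hc : 0 < c) {θ : ι → ℝ} (x : ι → ℝ)
    {s' s₀ : Finset ι} (hq : s₀.Nonempty → 0 < q) (hs' : bias r θ s' ≤ q)
    (hcard : s₀.card ≤ s'.card) :
    2 * ∑ k ∈ s', θ k * x k - 2 * ∑ k ∈ s₀, θ k * x k ≤
      2 * c * s'.card + driftBound c q θ x s₀ := by
  have hcard' : (s₀.card : ℝ) ≤ s'.card := by exact_mod_cast hcard
  have h1 : ∀ k, 2 * (θ k * x k) ≤ c + 1 / c * (θ k ^ 2 * x k ^ 2) := fun k => by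
    have : c + 1 / c * (θ k ^ 2 * x k ^ 2) - 2 * (θ k * x k) = (θ k * x k - c) ^ 2 / c := by
      field_simp; ring
    have : 0 ≤ (θ k * x k - c) ^ 2 / c := by positivity
    linarith
  have h1' : ∀ k, 0 ≤ 1 / c * (θ k ^ 2 * x k ^ 2) := fun k => by positivity
  rcases s₀.eq_empty_or_nonempty with rfl | hne
  · have : ∑ k ∈ s', 2 * (θ k * x k) ≤ ∑ k ∈ s', (c + 1 / c * (θ k ^ 2 * x k ^ 2)) :=
      Finset.sum_le_sum fun k _ => h1 k
    rw [Finset.sum_add_distrib, ← Finset.mul_sum, Finset.sum_const, nsmul_eq_mul] at this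
    have h2 : ∑ k ∈ s', 1 / c * (θ k ^ 2 * x k ^ 2) ≤ ∑ k, 1 / c * (θ k ^ 2 * x k ^ 2) :=
      Finset.sum_le_sum_of_subset_of_nonneg (Finset.subset_univ _) fun k _ _ => h1' k
    have h3 : 0 ≤ c * s'.card := by positivity
    simp only [driftBound, energy, Finset.sum_empty, Finset.compl_empty, Finset.mul_sum, mul_zero,
      add_zero, sub_zero] at *
    linarith
  · have hq := hq hne
    have hd : (0 : ℝ) < s₀.card := by exact_mod_cast hne.card_pos
    -- This weight makes the dropped coordinates cost at most `q / lam = c * s₀.card`, which `hcard`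
    -- bounds by `c * s'.card`.
    set lam : ℝ := q / (c * s₀.card) with hlam
    have hlam0 : 0 < lam := by positivity
    have h2 : ∀ k, -(2 * (θ k * x k)) ≤ 1 / lam * θ k ^ 2 + lam * x k ^ 2 := fun k => by
      have : 1 / lam * θ k ^ 2 + lam * x k ^ 2 + 2 * (θ k * x k) =
        (θ k + lam * x k) ^ 2 / lam := by field_simp; ring
      have : 0 ≤ (θ k + lam * x k) ^ 2 / lam := by positivity
      linarith
    have h3 : ∑ k ∈ s'ᶜ, θ k ^ 2 ≤ q := by simp only [bias] at hs'; linarith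
    have h4 : 1 / lam * ∑ k ∈ s'ᶜ, θ k ^ 2 ≤ c * s₀.card := by
      calc _ ≤ 1 / lam * q := by gcongr
        _ = _ := by rw [hlam]; field_simp
    have key : 2 * ∑ k ∈ s', θ k * x k - 2 * ∑ k ∈ s₀, θ k * x k ≤ ∑ k ∈ s', c +
        1 / c * ∑ k ∈ s₀ᶜ, θ k ^ 2 * x k ^ 2 + 1 / lam * ∑ k ∈ s'ᶜ, θ k ^ 2 +
        lam * energy x s₀ := by
      simp only [energy, sum_compl_eq_ite, sum_eq_ite s₀, sum_eq_ite s', Finset.mul_sum,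
        ← Finset.sum_add_distrib, ← Finset.sum_sub_distrib]
      refine Finset.sum_le_sum fun k _ => ?_
      have a1 := h1 k
      have a2 := h2 k
      have a3 := h1' k
      have a4 : 0 ≤ 1 / lam * θ k ^ 2 := by positivity
      have a5 : 0 ≤ lam * x k ^ 2 := by positivity
      by_cases hs : k ∈ s₀ <;> by_cases hs' : k ∈ s' <;> simp only [hs, hs', if_true, if_false] <;>
        linarith
    rw [Finset.sum_const, nsmul_eq_mul] at key
    simp only [driftBound, ← hlam]
    nlinarith

lemma cross_le_bias_add {r : ℝ} (hr : 0 ≤ r) (θ x : ι → ℝ) (s s' : Finset ι) {ε : ℝ} (hε : 0 < ε) :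
    2 * ∑ k ∈ s', θ k * x k - 2 * ∑ k ∈ s, θ k * x k ≤
      bias r θ s + energy x s' + ε * bias r θ s' + 1 / ε * energy x s := by
  have h0 : 0 ≤ ε * r := by positivity
  suffices h : 2 * ∑ k ∈ s', θ k * x k - 2 * ∑ k ∈ s, θ k * x k ≤
      ∑ k ∈ sᶜ, θ k ^ 2 + energy x s' + ε * ∑ k ∈ s'ᶜ, θ k ^ 2 + 1 / ε * energy x s by
    simp only [bias]; nlinarith
  simp only [energy, sum_compl_eq_ite, sum_eq_ite s, sum_eq_ite s', Finset.mul_sum,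
    ← Finset.sum_add_distrib, ← Finset.sum_sub_distrib]
  refine Finset.sum_le_sum fun k _ => ?_
  have h2 : -(2 * (θ k * x k)) ≤ ε * θ k ^ 2 + 1 / ε * x k ^ 2 := by
    have : ε * θ k ^ 2 + 1 / ε * x k ^ 2 + 2 * (θ k * x k) = (ε * θ k + x k) ^ 2 / ε := by
      field_simp; ring
    have : 0 ≤ (ε * θ k + x k) ^ 2 / ε := by positivity
    linarith
  have a4 : 0 ≤ ε * θ k ^ 2 := by positivity
  have a5 : 0 ≤ 1 / ε * x k ^ 2 := by positivity
  have a6 := sq_nonneg (x k)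
  have a7 := sq_nonneg (θ k)
  have a8 := sq_nonneg (θ k - x k)
  by_cases hs : k ∈ s <;> by_cases hs' : k ∈ s' <;> simp only [hs, hs', if_true, if_false] <;>
    nlinarith

/-- If the bias of `s'` is below eight times the target, `s₀` is no larger than `s'` and the drift
is paid by the penalty of `s'`. Otherwise the large bias pays. The linear term in `s₀` and `s` is
kept in both cases so that it can be integrated to zero. -/
lemma loss_le_of_large {r p p' c T w : ℝ} (hr : 0 ≤ r) (hp : 0 ≤ p) (hc : 0 < c) (hT : 0 ≤ T)
    {θ x : ι → ℝ} {s s' s₀ : Finset ι}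
    (h : -∑ k ∈ s', (θ k + x k) ^ 2 + p' ≤ -∑ k ∈ s, (θ k + x k) ^ 2 + p)
    (hw : energy x s' ≤ w + T) (hp' : 2 * c * s'.card + 2 * w ≤ p') (hp'' : 3 * w ≤ p')
    (hs₀ : bias r θ s₀ ≤ 8 * (bias r θ s + p))
    (hpos : s₀.Nonempty → 0 < bias r θ s + p)
    (hcard : bias r θ s' ≤ 8 * (bias r θ s + p) → s₀.card ≤ s'.card) :
    bias r θ s' + energy x s' ≤ bias r θ s + p +
      (2 * ∑ k ∈ s₀, θ k * x k - 2 * ∑ k ∈ s, θ k * x k) +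
      driftBound c (8 * (bias r θ s + p)) θ x s₀ + 13 * T + 18 * energy x s + energy x s₀ := by
  have hB := bias_nonneg hr θ s
  have hB' := bias_nonneg hr θ s'
  have hW := energy_nonneg x s
  have hW' := energy_nonneg x s'
  have hW₀ := energy_nonneg x s₀
  have hX := driftBound_nonneg hc (q := 8 * (bias r θ s + p)) (by positivity) θ x s₀
  have h1 := loss_le_of_crit_le (r := r) h
  by_cases hgood : bias r θ s' ≤ 8 * (bias r θ s + p)
  · have h2 := cross_le_driftBound hr hc x (fun hne => by have := hpos hne; positivity) hgood
      (hcard hgood)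
    linarith
  -- With `Q` the target `bias r θ s + p`, four times the resulting bound leaves `-2 bias r θ s' <
  -- -16 Q`, enough to cover `8 Q` and the possibly negative linear term, which `h3` bounds below.
  · have h2 := cross_le_bias_add hr θ x s s' (ε := 1 / 4) (by norm_num)
    have h3 := cross_le_bias_add hr θ x s₀ s (ε := 1) (by norm_num)
    norm_num at h2 h3
    push Not at hgood
    nlinarith

end Coordinates

/-! ### Integrated oracle inequality in coordinates -/

section Expectation

variable {ι : Type*} [Fintype ι] [DecidableEq ι] {Ω : Type*} [MeasurableSpace Ω]
  {P : Measure Ω} {x : ι → Ω → ℝ}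

lemma integrable_energy {ι : Type*} {x : ι → Ω → ℝ} (hx2 : ∀ k, Integrable (fun ω => x k ω ^ 2) P)
    (s : Finset ι) : Integrable (fun ω => energy (fun k => x k ω) s) P :=
  integrable_finsetSum _ fun k _ => hx2 k

lemma integral_energy_le {ι : Type*} {x : ι → Ω → ℝ} (hx2 : ∀ k, Integrable (fun ω => x k ω ^ 2) P)
    {w : ℝ} (hw : ∀ k, ∫ ω, x k ω ^ 2 ∂P ≤ w) (s : Finset ι) :
    ∫ ω, energy (fun k => x k ω) s ∂P ≤ s.card * w := by
  simp only [energy]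
  rw [integral_finsetSum _ fun k _ => hx2 k, ← nsmul_eq_mul]
  exact Finset.sum_le_card_nsmul _ _ _ fun k _ => hw k

lemma integral_linear_eq_zero {ι : Type*} {x : ι → Ω → ℝ} (hx1 : ∀ k, Integrable (x k) P)
    (hx0 : ∀ k, ∫ ω, x k ω ∂P = 0) (θ : ι → ℝ) (s : Finset ι) :
    ∫ ω, ∑ k ∈ s, θ k * x k ω ∂P = 0 := by
  rw [integral_finsetSum _ fun k _ => (hx1 k).const_mul _]
  exact Finset.sum_eq_zero fun k _ => by rw [integral_const_mul, hx0, mul_zero]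

lemma integrable_driftBound (hx2 : ∀ k, Integrable (fun ω => x k ω ^ 2) P) (c q : ℝ) (θ : ι → ℝ)
    (s : Finset ι) : Integrable (fun ω => driftBound c q θ (fun k => x k ω) s) P := by
  refine Integrable.add (Integrable.const_mul ?_ _) ((integrable_energy hx2 s).const_mul _)
  exact integrable_finsetSum _ fun k _ => (hx2 k).const_mul _

/-- Both terms have mean at most `q w / c`: the signal energy off `s` is bounded by the bias, and
the division by `s.card` normalizes the noise energy on `s`. -/
lemma integral_driftBound_le (hx2 : ∀ k, Integrable (fun ω => x k ω ^ 2) P) {w : ℝ} (hw0 : 0 ≤ w)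
    (hw : ∀ k, ∫ ω, x k ω ^ 2 ∂P ≤ w) {c q r : ℝ} (hc : 0 < c) (hq : 0 ≤ q) (hr : 0 ≤ r)
    (θ : ι → ℝ) (s : Finset ι) (hs : bias r θ s ≤ q) :
    ∫ ω, driftBound c q θ (fun k => x k ω) s ∂P ≤ 2 * q * w / c := by
  have hi : ∀ k, Integrable (fun ω => θ k ^ 2 * x k ω ^ 2) P := fun k => (hx2 k).const_mul _
  have h1 : ∫ ω, ∑ k ∈ sᶜ, θ k ^ 2 * x k ω ^ 2 ∂P ≤ q * w := by
    rw [integral_finsetSum _ fun k _ => hi k]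
    calc _ ≤ ∑ k ∈ sᶜ, θ k ^ 2 * w := Finset.sum_le_sum fun k _ => by
            rw [integral_const_mul]; exact mul_le_mul_of_nonneg_left (hw k) (sq_nonneg _)
      _ = (∑ k ∈ sᶜ, θ k ^ 2) * w := by rw [Finset.sum_mul]
      _ ≤ q * w := by
        refine mul_le_mul_of_nonneg_right ?_ hw0
        simp only [bias] at hs; linarith
  have h2 : q / (c * s.card) * ∫ ω, energy (fun k => x k ω) s ∂P ≤ q * w / c := by
    rcases s.eq_empty_or_nonempty with rfl | hne
    · simp; positivity
    · have hd : (0 : ℝ) < s.card := by exact_mod_cast hne.card_pos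
      calc _ ≤ q / (c * s.card) * (s.card * w) := by
            gcongr; exact integral_energy_le hx2 hw s
        _ = q * w / c := by field_simp
  simp only [driftBound]
  rw [integral_add, integral_const_mul, integral_const_mul]
  · calc _ ≤ 1 / c * (q * w) + q * w / c := by gcongr
      _ = _ := by ring
  · exact (integrable_finsetSum _ fun k _ => hi k).const_mul _
  · exact (integrable_energy hx2 s).const_mul _

lemma oracleConst_ge {K : ℝ} (hK : 1 < K) : 1 + 2 / K ≤ oracleConst K := by
  have hK1 : 0 < K - 1 := by linarith
  unfold oracleConst
  rw [le_div_iff₀ (by positivity)]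
  have : (1 + 2 / K) * (K - 1) ^ 3 = (K + 2) * (K - 1) ^ 3 / K := by field_simp
  rw [this, div_le_iff₀ (by linarith)]
  nlinarith [mul_pos hK1 hK1, mul_pos (mul_pos hK1 hK1) hK1]

lemma oracleConst_pos {K : ℝ} (hK : 1 < K) : 0 < oracleConst K := by
  have := oracleConst_ge hK
  have : 0 < 2 / K := by positivity
  linarith

lemma le_oracleConst {K : ℝ} (hK : 1 < K) :
    K ^ 2 / (K - 1) ^ 2 * (1 + 1 / K) ≤ oracleConst K := by
  have hK1 : 0 < K - 1 := by linarith
  unfold oracleConst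
  rw [show K ^ 2 / (K - 1) ^ 2 * (1 + 1 / K) = K * (K + 1) * (K - 1) / (K - 1) ^ 3 by
    field_simp]
  refine div_le_div_of_nonneg_right ?_ (by positivity)
  nlinarith

variable [IsProbabilityMeasure P] {α : Type*} {s : α → Finset ι} {M : Finset α}
  {r v K : ℝ} {θ : ι → ℝ} {Δ pen : α → ℝ} {mhat : Ω → α} {T : Ω → ℝ}

lemma integral_loss_le_of_small (hr : 0 ≤ r) (hK : 1 < K)
    (hx2 : ∀ k, Integrable (fun ω => x k ω ^ 2) P)
    (hpen : ∀ m ∈ M, K * (324 * v) * ((s m).card + Δ m) ≤ pen m)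
    (hTi : Integrable T P)
    (hT : ∀ m ∈ M, ∀ ω, energy (fun k => x k ω) (s m) ≤ 324 * v * ((s m).card + Δ m) + T ω)
    (hmem : ∀ ω, mhat ω ∈ M)
    (hmin : ∀ ω, ∀ m ∈ M, -∑ k ∈ s (mhat ω), (θ k + x k ω) ^ 2 + pen (mhat ω) ≤
      -∑ k ∈ s m, (θ k + x k ω) ^ 2 + pen m)
    (hL : Integrable (fun ω => bias r θ (s (mhat ω)) + energy (fun k => x k ω) (s (mhat ω))) P)
    {m : α} (hm : m ∈ M) :
    ∫ ω, bias r θ (s (mhat ω)) + energy (fun k => x k ω) (s (mhat ω)) ∂P ≤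
      oracleConst K * bias r θ (s m) + K ^ 2 / (K - 1) ^ 2 *
        (pen m + K * ∫ ω, energy (fun k => x k ω) (s m) ∂P + K * ∫ ω, T ω ∂P) := by
  have hK0 : 0 < K := by linarith
  have hpt : ∀ ω, bias r θ (s (mhat ω)) + energy (fun k => x k ω) (s (mhat ω)) ≤
      oracleConst K * bias r θ (s m) + K ^ 2 / (K - 1) ^ 2 *
        (pen m + K * energy (fun k => x k ω) (s m) + K * T ω) := fun ω => by
    refine loss_le_of_small hr hK (hmin ω m hm) ?_
    have h1 := hT _ (hmem ω) ω
    have h2 := hpen _ (hmem ω)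
    nlinarith
  have hei := integrable_energy hx2 (s m)
  have hi1 : Integrable (fun ω => pen m + K * energy (fun k => x k ω) (s m)) P :=
    (integrable_const _).add (hei.const_mul _)
  have hi2 : Integrable (fun ω => pen m + K * energy (fun k => x k ω) (s m) + K * T ω) P :=
    hi1.add (hTi.const_mul _)
  have hle := integral_mono hL ((integrable_const _).add (hi2.const_mul _)) hpt
  refine hle.trans ?_
  rw [integral_add' (integrable_const _) (hi2.const_mul _), integral_const_mul (K ^ 2 / (K - 1) ^ 2),
    integral_add hi1 (hTi.const_mul _), integral_add (integrable_const _) (hei.const_mul _)]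
  simp only [integral_const, integral_const_mul, probReal_univ, one_smul, le_refl]

lemma integral_loss_le_of_large (hr : 0 ≤ r) (hv : 0 < v) (hK : 4 ≤ K)
    (hx1 : ∀ k, Integrable (x k) P) (hx0 : ∀ k, ∫ ω, x k ω ∂P = 0)
    (hx2 : ∀ k, Integrable (fun ω => x k ω ^ 2) P) (hxv : ∀ k, ∫ ω, x k ω ^ 2 ∂P ≤ 4 * v)
    (hΔ : ∀ m ∈ M, 0 ≤ Δ m) (hpen : ∀ m ∈ M, K * (324 * v) * ((s m).card + Δ m) ≤ pen m)
    (hTi : Integrable T P) (hT0 : ∀ ω, 0 ≤ T ω)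
    (hT : ∀ m ∈ M, ∀ ω, energy (fun k => x k ω) (s m) ≤ 324 * v * ((s m).card + Δ m) + T ω)
    (hmem : ∀ ω, mhat ω ∈ M)
    (hmin : ∀ ω, ∀ m ∈ M, -∑ k ∈ s (mhat ω), (θ k + x k ω) ^ 2 + pen (mhat ω) ≤
      -∑ k ∈ s m, (θ k + x k ω) ^ 2 + pen m)
    (hL : Integrable (fun ω => bias r θ (s (mhat ω)) + energy (fun k => x k ω) (s (mhat ω))) P)
    {m : α} (hm : m ∈ M) :
    ∫ ω, bias r θ (s (mhat ω)) + energy (fun k => x k ω) (s (mhat ω)) ∂P ≤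
      (1 + 2 / K) * (bias r θ (s m) + pen m) + 15 * ∫ ω, T ω ∂P := by
  classical
  have hK0 : 0 < K := by linarith
  have hB := bias_nonneg hr θ (s m)
  have hpm : 324 * v * K * (s m).card ≤ pen m := by
    have h3 : 0 ≤ K * (324 * v) * Δ m := mul_nonneg (by positivity) (hΔ m hm)
    have := hpen m hm
    linarith
  have hp : 0 ≤ pen m := le_trans (by positivity) hpm
  set Q := bias r θ (s m) + pen m with hQ
  have hQ0 : 0 ≤ Q := by positivity
  -- The reference model has minimal cardinality among those of bias at most `8 * Q`; `m` itself is
  -- a candidate, so the reference is no larger than `m`.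
  obtain ⟨m₀, hm₀, hmin₀⟩ := Finset.exists_min_image (M.filter fun m' => bias r θ (s m') ≤ 8 * Q)
    (fun m' => (s m').card) ⟨m, Finset.mem_filter.2 ⟨hm, by linarith⟩⟩
  simp only [Finset.mem_filter] at hm₀ hmin₀
  have hcard₀ : (s m₀).card ≤ (s m).card := hmin₀ m ⟨hm, by linarith⟩
  -- The largest price per coordinate for which `2 * c * card` plus twice the noise allowance still
  -- fits in the penalty; `K ≥ 4` makes it at least `81 * K * v`.
  set c := (K / 2 - 1) * (324 * v) with hc
  have hcK : 81 * K * v ≤ c := by rw [hc]; nlinarith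
  have hc0 : 0 < c := lt_of_lt_of_le (by positivity) hcK
  have hpt : ∀ ω, bias r θ (s (mhat ω)) + energy (fun k => x k ω) (s (mhat ω)) ≤
      Q + (2 * ∑ k ∈ s m₀, θ k * x k ω - 2 * ∑ k ∈ s m, θ k * x k ω) +
      driftBound c (8 * Q) θ (fun k => x k ω) (s m₀) + 13 * T ω +
      18 * energy (fun k => x k ω) (s m) + energy (fun k => x k ω) (s m₀) := fun ω => by
    have hd := hΔ _ (hmem ω)
    have hw : 0 ≤ 324 * v * ((s (mhat ω)).card + Δ (mhat ω)) := by positivity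
    refine loss_le_of_large hr hp hc0 (hT0 ω) (hmin ω m hm) (hT _ (hmem ω) ω) ?_ ?_ hm₀.2 ?_ ?_
    · refine le_trans ?_ (hpen _ (hmem ω))
      rw [hc]
      have : 0 ≤ (K / 2 - 1) * (324 * v) * Δ (mhat ω) := by positivity
      nlinarith
    · refine le_trans ?_ (hpen _ (hmem ω))
      nlinarith
    · intro hne
      have h1 : 1 ≤ (s m₀).card := hne.card_pos
      have h2 : (1 : ℝ) ≤ (s m).card := by exact_mod_cast h1.trans hcard₀
      have : 324 * v * K * 1 ≤ 324 * v * K * (s m).card := by gcongr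
      have : 0 < 324 * v * K := by positivity
      linarith
    · exact fun h => hmin₀ _ ⟨hmem ω, h⟩
  have hlin : ∀ t : Finset ι, Integrable (fun ω => 2 * ∑ k ∈ t, θ k * x k ω) P := fun t =>
    (integrable_finsetSum _ fun k _ => (hx1 k).const_mul _).const_mul _
  have hsub : Integrable (fun ω => 2 * ∑ k ∈ s m₀, θ k * x k ω - 2 * ∑ k ∈ s m, θ k * x k ω) P :=
    (hlin _).sub (hlin _)
  have i1 : Integrable (fun ω => Q + (2 * ∑ k ∈ s m₀, θ k * x k ω - 2 * ∑ k ∈ s m, θ k * x k ω)) P :=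
    (integrable_const _).add hsub
  have i2 := i1.add (integrable_driftBound hx2 c (8 * Q) θ (s m₀))
  have i3 := i2.add (hTi.const_mul 13)
  have i4 := i3.add ((integrable_energy hx2 (s m)).const_mul 18)
  have i5 := i4.add (integrable_energy hx2 (s m₀))
  refine (integral_mono hL i5 hpt).trans ?_
  rw [integral_add' i4 (integrable_energy hx2 (s m₀)),
    integral_add' i3 ((integrable_energy hx2 (s m)).const_mul 18),
    integral_add' i2 (hTi.const_mul 13),
    integral_add' i1 (integrable_driftBound hx2 c (8 * Q) θ (s m₀)),
    integral_add (integrable_const _) hsub,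
    integral_sub (hlin _) (hlin _)]
  simp only [integral_const_mul, integral_linear_eq_zero hx1 hx0, integral_const, probReal_univ,
    one_smul]
  have e1 := integral_energy_le hx2 hxv (s m)
  have e2 := integral_energy_le hx2 hxv (s m₀)
  have e3 := integral_driftBound_le hx2 (by positivity) hxv hc0 (q := 8 * Q) (by positivity) hr θ
    (s m₀) hm₀.2
  -- The drift costs `64/81` and the energies `76/324` of `Q / K`, together below the available `2 *
  -- (Q / K)`.
  have e4 : 2 * (8 * Q) * (4 * v) / c ≤ 64 / 81 * (Q / K) := by
    rw [div_le_iff₀ hc0]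
    calc 2 * (8 * Q) * (4 * v) = 64 / 81 * (Q / K) * (81 * K * v) := by field_simp; ring
      _ ≤ _ := by gcongr
  have e5 : ((s m₀).card : ℝ) * (4 * v) ≤ (s m).card * (4 * v) := by gcongr
  have e6 : 76 * v * (s m).card ≤ 76 / 324 * (Q / K) := by
    have : 76 / 324 * (Q / K) = 76 / 324 * Q / K := by ring
    rw [this, le_div_iff₀ hK0]
    linarith
  have e7 : 0 ≤ ∫ ω, T ω ∂P := integral_nonneg hT0
  have e8 : 0 ≤ Q / K := by positivity
  have e9 : (1 + 2 / K) * Q = Q + 2 * (Q / K) := by ring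
  rw [e9]
  linarith

/-- The oracle inequality for penalized projection estimators in coordinates, given a control `T` of
the noise energy in excess of the penalty. -/
theorem integral_loss_le (hr : 0 ≤ r) (hv : 0 ≤ v) (hK : 1 < K)
    (hx1 : ∀ k, Integrable (x k) P) (hx0 : ∀ k, ∫ ω, x k ω ∂P = 0)
    (hx2 : ∀ k, Integrable (fun ω => x k ω ^ 2) P) (hxv : ∀ k, ∫ ω, x k ω ^ 2 ∂P ≤ 4 * v)
    (hΔ : ∀ m ∈ M, 0 ≤ Δ m) (hpen : ∀ m ∈ M, K * (324 * v) * ((s m).card + Δ m) ≤ pen m)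
    (hTi : Integrable T P) (hT0 : ∀ ω, 0 ≤ T ω)
    (hT : ∀ m ∈ M, ∀ ω, energy (fun k => x k ω) (s m) ≤ 324 * v * ((s m).card + Δ m) + T ω)
    (hmem : ∀ ω, mhat ω ∈ M)
    (hmin : ∀ ω, ∀ m ∈ M, -∑ k ∈ s (mhat ω), (θ k + x k ω) ^ 2 + pen (mhat ω) ≤
      -∑ k ∈ s m, (θ k + x k ω) ^ 2 + pen m)
    (hL : Integrable (fun ω => bias r θ (s (mhat ω)) + energy (fun k => x k ω) (s (mhat ω))) P)
    {m : α} (hm : m ∈ M) :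
    ∫ ω, bias r θ (s (mhat ω)) + energy (fun k => x k ω) (s (mhat ω)) ∂P ≤
      oracleConst K * (bias r θ (s m) + pen m + 15 * ∫ ω, T ω ∂P) := by
  have hK0 : 0 < K := by linarith
  have hB := bias_nonneg hr θ (s m)
  have hp : 0 ≤ pen m := le_trans
    (mul_nonneg (by positivity) (add_nonneg (Nat.cast_nonneg _) (hΔ m hm))) (hpen m hm)
  have hC := oracleConst_ge hK
  have hC0 := oracleConst_pos hK
  have e7 : 0 ≤ ∫ ω, T ω ∂P := integral_nonneg hT0
  rcases le_total K 4 with h4 | h4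
  · have h1 := integral_loss_le_of_small hr hK hx2 hpen hTi hT hmem hmin hL hm
    have h2 : (4 / 324 : ℝ) ≤ 1 / K := by rw [le_div_iff₀ hK0]; linarith
    have h3 : K * ∫ ω, energy (fun k => x k ω) (s m) ∂P ≤ 1 / K * pen m := by
      have h3 := integral_energy_le hx2 hxv (s m)
      have h4 : 0 ≤ K * (324 * v) * Δ m := mul_nonneg (by positivity) (hΔ m hm)
      have h5 := hpen m hm
      have h6 : 4 / 324 * pen m ≤ 1 / K * pen m := by gcongr
      nlinarith
    have h4 : K ^ 2 / (K - 1) ^ 2 * (pen m + K * ∫ ω, energy (fun k => x k ω) (s m) ∂P +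
        K * ∫ ω, T ω ∂P) ≤ oracleConst K * (pen m + 15 * ∫ ω, T ω ∂P) := by
      calc _ ≤ K ^ 2 / (K - 1) ^ 2 * ((1 + 1 / K) * (pen m + 15 * ∫ ω, T ω ∂P)) := by
            gcongr
            have : 0 ≤ 1 / K * ∫ ω, T ω ∂P := by positivity
            nlinarith
        _ = K ^ 2 / (K - 1) ^ 2 * (1 + 1 / K) * (pen m + 15 * ∫ ω, T ω ∂P) := by ring
        _ ≤ _ := by gcongr; exact le_oracleConst hK
    linarith
  · rcases hv.eq_or_lt with rfl | hv
    -- When `v = 0` the noise energy has mean zero, so the argument for small `K` applies with the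
    -- total energy in place of `T`, and its factor `K` is harmless.
    · have hz : ∀ t : Finset ι, ∫ ω, energy (fun k => x k ω) t ∂P = 0 := fun t =>
        le_antisymm (by simpa using integral_energy_le hx2 hxv t)
          (integral_nonneg fun ω => energy_nonneg _ _)
      have h1 := integral_loss_le_of_small (T := fun ω => energy (fun k => x k ω) Finset.univ)
        hr hK hx2 hpen (integrable_energy hx2 _)
        (fun m _ ω => by
          simpa [energy] using Finset.sum_le_sum_of_subset_of_nonneg (Finset.subset_univ (s m))
            fun k _ _ => sq_nonneg (x k ω)) hmem hmin hL hm
      rw [hz, hz] at h1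
      have h2 : K ^ 2 / (K - 1) ^ 2 * pen m ≤ oracleConst K * pen m := by
        gcongr
        refine le_trans ?_ (le_oracleConst hK)
        have : 0 ≤ K ^ 2 / (K - 1) ^ 2 * (1 / K) := by positivity
        linarith
      have h3 : 0 ≤ oracleConst K * (15 * ∫ ω, T ω ∂P) := by positivity
      linarith
    · have h1 := integral_loss_le_of_large hr hv h4 hx1 hx0 hx2 hxv hΔ hpen hTi hT0 hT hmem hmin hL
        hm
      have : 0 ≤ 2 / K := by positivity
      nlinarith

end Expectation

/-! ### Laplace transform and second moments of the noise -/

section Laplace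

variable {Ω : Type*} [MeasurableSpace Ω] {P : Measure Ω} [IsProbabilityMeasure P] {n : ℕ}
  {σ c : ℝ} {ξ : Fin n → Ω → ℝ}

/-- The noise vector. -/
noncomputable def noise {Ω : Type*} {n : ℕ} (ξ : Fin n → Ω → ℝ) (ω : Ω) :
    EuclideanSpace ℝ (Fin n) :=
  WithLp.toLp 2 fun i => ξ i ω

lemma measurable_noise {Ω : Type*} [MeasurableSpace Ω] {n : ℕ} {ξ : Fin n → Ω → ℝ}
    (hξ : ∀ i, Measurable (ξ i)) : Measurable (noise ξ) :=
  (WithLp.measurable_toLp 2 _).comp (measurable_pi_lambda _ hξ)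

lemma inner_noise {Ω : Type*} {n : ℕ} (ξ : Fin n → Ω → ℝ) (t : EuclideanSpace ℝ (Fin n)) (ω : Ω) :
    inner ℝ t (noise ξ ω) = ∑ i, t i * ξ i ω := by
  simp [noise, PiLp.inner_apply, mul_comm]

/-- On half of the admissible range the denominator `2(1 - |l|c)` is at least `1`, so the bound is
sub-Gaussian. -/
lemma BernsteinCondition.integral_exp_le {X : Ω → ℝ} (h : BernsteinCondition P σ c X) {l : ℝ}
    (hl : |l| * c ≤ 1 / 2) : ∫ ω, Real.exp (l * X ω) ∂P ≤ Real.exp (σ ^ 2 * l ^ 2) := by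
  obtain ⟨h1, h2⟩ := h l (by linarith)
  rw [← Real.log_le_iff_le_exp (integral_exp_pos h1)]
  refine h2.trans ?_
  rw [div_le_iff₀ (by linarith)]
  have : 0 ≤ σ ^ 2 * l ^ 2 := by positivity
  nlinarith

lemma integrable_exp_inner_noise (hξ : ∀ i, Measurable (ξ i)) (hind : iIndepFun ξ P)
    (hb : ∀ i, BernsteinCondition P σ c (ξ i)) {t : EuclideanSpace ℝ (Fin n)}
    (ht : ∀ i, |t i| * c ≤ 1 / 2) :
    Integrable (fun ω => Real.exp (inner ℝ t (noise ξ ω))) P ∧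
      ∫ ω, Real.exp (inner ℝ t (noise ξ ω)) ∂P ≤ Real.exp (σ ^ 2 * ‖t‖ ^ 2) := by
  have hX : ∀ i, Measurable (fun ω => t i * ξ i ω) := fun i => (hξ i).const_mul _
  have hindX : iIndepFun (fun i ω => t i * ξ i ω) P :=
    hind.comp (fun i y => t i * y) fun i => measurable_const_mul _
  have hint : ∀ i ∈ Finset.univ, Integrable (fun ω => Real.exp (1 * (t i * ξ i ω))) P := fun i _ => by
    simpa using (hb i (t i) (by linarith [ht i])).1
  have h1 := hindX.integrable_exp_mul_sum hX hint
  have h2 := hindX.mgf_sum (t := 1) hX Finset.univ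
  have e : ∀ ω, Real.exp (1 * (∑ i, fun ω => t i * ξ i ω) ω) =
      Real.exp (inner ℝ t (noise ξ ω)) := fun ω => by
    rw [inner_noise, one_mul, Finset.sum_apply]
  simp only [mgf, e] at h1 h2
  refine ⟨h1, h2.trans_le ?_⟩
  calc _ ≤ ∏ i, Real.exp (σ ^ 2 * t i ^ 2) := by
        refine Finset.prod_le_prod (fun i _ => integral_nonneg fun ω => (Real.exp_pos _).le)
          fun i _ => ?_
        simpa using (hb i).integral_exp_le (ht i)
    _ = _ := by
        rw [← Real.exp_sum, ← Finset.mul_sum, EuclideanSpace.norm_sq_eq]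
        simp

lemma abs_apply_le_norm {n : ℕ} (x : EuclideanSpace ℝ (Fin n)) (i : Fin n) : |x i| ≤ ‖x‖ := by
  simpa using PiLp.norm_apply_le x i

lemma sq_le_exp_add_exp_neg (y : ℝ) : y ^ 2 ≤ Real.exp y + Real.exp (-y) - 2 := by
  have h := Real.cosh_eq y
  have h2 := Real.cosh_two_mul (y / 2)
  have h3 := Real.cosh_sq (y / 2)
  have h4 : (y / 2) ^ 2 ≤ Real.sinh (y / 2) ^ 2 := by
    rw [sq_le_sq]
    rcases le_total 0 (y / 2) with h | h
    · rw [abs_of_nonneg h, abs_of_nonneg (Real.sinh_nonneg_iff.2 h)]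
      exact Real.self_le_sinh_iff.2 h
    · rw [abs_of_nonpos h, abs_of_nonpos (Real.sinh_nonpos_iff.2 h)]
      exact neg_le_neg (Real.sinh_le_self_iff.2 h)
  rw [mul_div_cancel₀ y two_ne_zero] at h2
  nlinarith

/-- A variable whose Laplace transform is bounded by that of a Gaussian near `0` is square
integrable, with a variance of the right order. -/
lemma integral_sq_le_of_exp_le {X : Ω → ℝ} (hX : Measurable X) {l : ℝ} (hl : 0 < l)
    (hls : σ ^ 2 * l ^ 2 ≤ 1)
    (h : ∀ u : ℝ, |u| ≤ l → Integrable (fun ω => Real.exp (u * X ω)) P ∧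
      ∫ ω, Real.exp (u * X ω) ∂P ≤ Real.exp (σ ^ 2 * u ^ 2)) :
    Integrable (fun ω => X ω ^ 2) P ∧ ∫ ω, X ω ^ 2 ∂P ≤ 4 * σ ^ 2 := by
  obtain ⟨i1, h1⟩ := h l (abs_of_pos hl).le
  obtain ⟨i2, h2⟩ := h (-l) (by rw [abs_neg, abs_of_pos hl])
  have i12 : Integrable (fun ω => Real.exp (l * X ω) + Real.exp (-l * X ω)) P := i1.add i2
  have i3 : Integrable (fun ω => Real.exp (l * X ω) + Real.exp (-l * X ω) - 2) P :=
    i12.sub (integrable_const _)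
  -- After integration the right side is at most `2(exp(σ²l²) - 1) ≤ 4σ²l²`, hence the constant `4`.
  have hle : ∀ ω, l ^ 2 * X ω ^ 2 ≤ Real.exp (l * X ω) + Real.exp (-l * X ω) - 2 := fun ω => by
    have := sq_le_exp_add_exp_neg (l * X ω)
    rwa [mul_pow, ← neg_mul] at this
  have i4 : Integrable (fun ω => l ^ 2 * X ω ^ 2) P := by
    refine i3.mono' ((hX.pow_const 2).const_mul _).aestronglyMeasurable (ae_of_all _ fun ω => ?_)
    rw [Real.norm_of_nonneg (by positivity)]
    exact hle ω
  have h3 := integral_mono i4 i3 hle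
  rw [integral_sub i12 (integrable_const _), integral_add i1 i2, integral_const_mul] at h3
  simp only [integral_const, probReal_univ, one_smul] at h3
  have h4 : Real.exp (σ ^ 2 * l ^ 2) ≤ 1 + 2 * (σ ^ 2 * l ^ 2) := by
    have hy : 0 ≤ σ ^ 2 * l ^ 2 := by positivity
    have := Real.abs_exp_sub_one_le (x := σ ^ 2 * l ^ 2) (by rwa [abs_of_nonneg hy])
    rw [abs_of_nonneg hy] at this
    linarith [(abs_le.1 this).2]
  rw [neg_sq] at h2
  have hl2 : 0 < l ^ 2 := by positivity
  refine ⟨?_, le_of_mul_le_mul_left ?_ hl2⟩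
  · have := i4.const_mul (l ^ 2)⁻¹
    simpa [← mul_assoc, hl2.ne'] using this
  · linarith

end Laplace

/-! ### Quadratic exponential moments by averaging the Laplace transform -/

section Mixture

open scoped Pointwise

variable {Ω : Type*} [MeasurableSpace Ω] {P : Measure Ω} [IsProbabilityMeasure P]
  {V : Type*} [NormedAddCommGroup V] [InnerProductSpace ℝ V] [FiniteDimensional ℝ V]
  [MeasurableSpace V] [BorelSpace V]

lemma lintegral_comp_two_smul (μ : Measure V) [μ.IsAddHaarMeasure] {g : V → ENNReal} (hg : Measurable g) :
    ∫⁻ s, g s ∂μ = 2 ^ Module.finrank ℝ V * ∫⁻ h, g ((2 : ℝ) • h) ∂μ := by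
  have h1 := lintegral_map (μ := μ) hg (measurable_const_smul (2 : ℝ))
  rw [Measure.map_addHaar_smul μ two_ne_zero, lintegral_smul_measure] at h1
  rw [← h1, smul_eq_mul, ← mul_assoc, abs_of_pos (by positivity), ENNReal.ofReal_inv_of_pos (by positivity),
    ENNReal.ofReal_pow zero_le_two, ENNReal.ofReal_ofNat, ENNReal.mul_inv_cancel (by simp) (by simp),
    one_mul]

/-- A quadratic exponential moment bound obtained by averaging the Laplace transform over a
convex neighbourhood of the origin. -/
lemma lintegral_exp_norm_sq_le {Z : Ω → V} (hZ : Measurable Z) {B : Set V} (hconv : Convex ℝ B)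
    (hmeas : MeasurableSet B) (hB0 : B ∈ nhds (0 : V)) (hBb : Bornology.IsBounded B) {τ : ℝ}
    (hτ : 0 < τ)
    (hL : ∀ t ∈ B, ∫⁻ ω, ENNReal.ofReal (Real.exp (inner ℝ ((2 : ℝ) • t) (Z ω))) ∂P ≤
      ENNReal.ofReal (Real.exp (τ * ‖(2 : ℝ) • t‖ ^ 2)))
    {A : Set Ω} (hAB : ∀ ω ∈ A, (3 / (8 * τ)) • Z ω ∈ B) (hA : MeasurableSet A) :
    ∫⁻ ω in A, ENNReal.ofReal (Real.exp (3 / (16 * τ) * ‖Z ω‖ ^ 2)) ∂P ≤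
      2 ^ Module.finrank ℝ V := by
  let μ : Measure V := Measure.addHaar
  -- The test weight is `exp(-λ‖s‖²)` on `2B`. After the Laplace bound the exponent is `-(λ -
  -- τ)‖s‖²`, and `s = 2h` turns it into `-4(λ - τ)‖h‖²`. The choice `λ = 4τ/3` makes this `-λ‖h‖²`,
  -- so the same `I` appears on both sides and cancels, leaving the Jacobian `2^d`.
  set I : ENNReal := ∫⁻ h in B, ENNReal.ofReal (Real.exp (-(4 / 3 * τ) * ‖h‖ ^ 2)) ∂μ with hI
  have hIm : Measurable fun h : V => ENNReal.ofReal (Real.exp (-(4 / 3 * τ) * ‖h‖ ^ 2)) := by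
    fun_prop
  have hI0 : I ≠ 0 := by
    rw [hI, ← pos_iff_ne_zero, setLIntegral_pos_iff hIm]
    have : Function.support (fun h : V => ENNReal.ofReal (Real.exp (-(4 / 3 * τ) * ‖h‖ ^ 2))) =
        Set.univ := by
      ext h; simp [Real.exp_pos]
    rw [this, Set.univ_inter]
    exact Measure.measure_pos_of_mem_nhds μ hB0
  have hItop : I ≠ ⊤ := by
    refine ne_top_of_le_ne_top hBb.measure_lt_top.ne (b := μ B) ?_
    calc I ≤ ∫⁻ _ in B, 1 ∂μ := lintegral_mono fun h => by
          rw [← ENNReal.ofReal_one]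
          refine ENNReal.ofReal_le_ofReal (Real.exp_le_one_iff.2 ?_)
          have : 0 ≤ 4 / 3 * τ * ‖h‖ ^ 2 := by positivity
          linarith
      _ = μ B := by simp
  have hB2 : MeasurableSet ((2 : ℝ) • B) := hmeas.const_smul₀ 2
  have hmem2 : ∀ h : V, (2 : ℝ) • h ∈ (2 : ℝ) • B ↔ h ∈ B := fun h =>
    Set.smul_mem_smul_set_iff₀ two_ne_zero _ _
  have hnorm : ∫⁻ s in (2 : ℝ) • B, ENNReal.ofReal (Real.exp (-(τ / 3) * ‖s‖ ^ 2)) ∂μ =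
      2 ^ Module.finrank ℝ V * I := by
    have hm : Measurable fun s : V => ENNReal.ofReal (Real.exp (-(τ / 3) * ‖s‖ ^ 2)) := by fun_prop
    rw [← lintegral_indicator hB2, lintegral_comp_two_smul μ (hm.indicator hB2), hI,
      ← lintegral_indicator hmeas]
    congr 2 with h
    by_cases hh : h ∈ B
    · rw [Set.indicator_of_mem hh, Set.indicator_of_mem ((hmem2 h).2 hh), norm_smul, Real.norm_ofNat]
      ring_nf
    · rw [Set.indicator_of_notMem hh, Set.indicator_of_notMem fun h' => hh ((hmem2 h).1 h')]
  have hlow : ∀ ω ∈ A, ENNReal.ofReal (Real.exp (3 / (16 * τ) * ‖Z ω‖ ^ 2)) * I ≤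
      ∫⁻ s in (2 : ℝ) • B,
        ENNReal.ofReal (Real.exp (inner ℝ s (Z ω) - 4 / 3 * τ * ‖s‖ ^ 2)) ∂μ := by
    intro ω hω
    rw [← lintegral_indicator hB2, ← lintegral_add_right_eq_self _ ((3 / (8 * τ)) • Z ω), hI,
      ← lintegral_const_mul _ hIm, ← lintegral_indicator hmeas]
    refine lintegral_mono fun h => ?_
    by_cases hh : h ∈ B
    -- The shift `3/(8τ) Z` completes the square. Convexity puts the midpoint of `h` and the shift
    -- in `B`, so their sum is in `2B`.
    · have hmem : h + (3 / (8 * τ)) • Z ω ∈ (2 : ℝ) • B := by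
        have := hconv hh (hAB ω hω) (a := 1 / 2) (b := 1 / 2) (by norm_num) (by norm_num)
          (by norm_num)
        refine ⟨_, this, ?_⟩
        simp [smul_add, smul_smul]
      rw [Set.indicator_of_mem hh, Set.indicator_of_mem hmem, ← ENNReal.ofReal_mul (Real.exp_pos _).le,
        ← Real.exp_add]
      refine ENNReal.ofReal_le_ofReal (Real.exp_le_exp.2 (le_of_eq ?_))
      rw [norm_add_sq_real, inner_add_left, inner_smul_left, inner_smul_right, norm_smul, mul_pow,
        real_inner_self_eq_norm_sq, Real.norm_of_nonneg (by positivity)]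
      simp only [conj_trivial]
      field_simp
      ring
    · rw [Set.indicator_of_notMem hh]
      exact zero_le
  have hjoint : Measurable (Function.uncurry fun (ω : Ω) (s : V) =>
      ENNReal.ofReal (Real.exp (inner ℝ s (Z ω) - 4 / 3 * τ * ‖s‖ ^ 2))) := by
    refine (Real.measurable_exp.comp ?_).ennreal_ofReal
    exact (measurable_snd.inner (hZ.comp measurable_fst)).sub (by fun_prop)
  have hexpm : Measurable fun ω => ENNReal.ofReal (Real.exp (3 / (16 * τ) * ‖Z ω‖ ^ 2)) := by
    fun_prop
  have key : (∫⁻ ω in A, ENNReal.ofReal (Real.exp (3 / (16 * τ) * ‖Z ω‖ ^ 2)) ∂P) * I ≤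
      2 ^ Module.finrank ℝ V * I := by
    calc _ = ∫⁻ ω in A, ENNReal.ofReal (Real.exp (3 / (16 * τ) * ‖Z ω‖ ^ 2)) * I ∂P :=
          (lintegral_mul_const _ hexpm).symm
      _ ≤ ∫⁻ ω in A, ∫⁻ s in (2 : ℝ) • B,
            ENNReal.ofReal (Real.exp (inner ℝ s (Z ω) - 4 / 3 * τ * ‖s‖ ^ 2)) ∂μ ∂P :=
          setLIntegral_mono' hA hlow
      _ ≤ ∫⁻ ω, ∫⁻ s in (2 : ℝ) • B,
            ENNReal.ofReal (Real.exp (inner ℝ s (Z ω) - 4 / 3 * τ * ‖s‖ ^ 2)) ∂μ ∂P :=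
          setLIntegral_le_lintegral _ _
      _ = ∫⁻ s in (2 : ℝ) • B, ∫⁻ ω,
            ENNReal.ofReal (Real.exp (inner ℝ s (Z ω) - 4 / 3 * τ * ‖s‖ ^ 2)) ∂P ∂μ :=
          lintegral_lintegral_swap hjoint.aemeasurable
      _ ≤ ∫⁻ s in (2 : ℝ) • B, ENNReal.ofReal (Real.exp (-(τ / 3) * ‖s‖ ^ 2)) ∂μ := by
          refine setLIntegral_mono' hB2 ?_
          rintro _ ⟨t, ht, rfl⟩
          have hm : Measurable fun ω => ENNReal.ofReal (Real.exp (inner ℝ ((2 : ℝ) • t) (Z ω))) := by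
            fun_prop
          simp only [sub_eq_add_neg, Real.exp_add, ENNReal.ofReal_mul (Real.exp_pos _).le]
          rw [lintegral_mul_const _ hm]
          refine (mul_le_mul_left (hL t ht) _).trans ?_
          rw [← ENNReal.ofReal_mul (Real.exp_pos _).le, ← Real.exp_add]
          refine ENNReal.ofReal_le_ofReal (Real.exp_le_exp.2 (le_of_eq ?_))
          ring
      _ = _ := hnorm
  exact (ENNReal.mul_le_mul_iff_left hI0 hItop).1 key

end Mixture

/-! ### Projections on spans of orthonormal vectors, in coordinates -/

section Projection

variable {E : Type*} [NormedAddCommGroup E] [InnerProductSpace ℝ E]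
  {ι : Type*} {b : ι → E}

lemma finrank_span_image (hon : Orthonormal ℝ b) (s : Finset ι) :
    Module.finrank ℝ (Submodule.span ℝ (b '' (s : Set ι))) = s.card := by
  have h := finrank_span_eq_card (hon.linearIndependent.comp (fun k : s => (k : ι))
    Subtype.val_injective)
  rw [Fintype.card_coe] at h
  have hs : Set.range (fun k : s => (k : ι)) = s := by ext; simp
  rw [Set.range_comp, hs] at h
  exact h

lemma starProjection_span_image [FiniteDimensional ℝ E] (hon : Orthonormal ℝ b)
    (s : Finset ι) (y : E) :
    (Submodule.span ℝ (b '' (s : Set ι))).starProjection y = ∑ k ∈ s, (inner ℝ (b k) y : ℝ) • b k := by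
  refine (Submodule.eq_starProjection_of_mem_of_inner_eq_zero ?_ ?_)
  · exact Submodule.sum_mem _ fun k hk =>
      Submodule.smul_mem _ _ (Submodule.subset_span ⟨k, hk, rfl⟩)
  · intro w hw
    induction hw using Submodule.span_induction with
    | mem x hx =>
      obtain ⟨k, hk, rfl⟩ := hx
      rw [real_inner_comm, inner_sub_right, hon.inner_right_sum _ hk, sub_self]
    | zero => exact inner_zero_right _
    | add x y _ _ hx hy => rw [inner_add_right, hx, hy, add_zero]
    | smul a x _ hx => rw [inner_smul_right, hx, mul_zero]

lemma norm_sum_smul_sq (hon : Orthonormal ℝ b) (s : Finset ι) (a : ι → ℝ) :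
    ‖∑ k ∈ s, a k • b k‖ ^ 2 = ∑ k ∈ s, a k ^ 2 := by
  rw [← real_inner_self_eq_norm_sq, hon.inner_sum]
  exact Finset.sum_congr rfl fun k _ => by simp [sq]

lemma norm_sub_sum_smul_sq (hon : Orthonormal ℝ b) (s : Finset ι) (a : ι → ℝ) (y : E) :
    ‖y - ∑ k ∈ s, a k • b k‖ ^ 2 =
      ‖y‖ ^ 2 - 2 * ∑ k ∈ s, a k * inner ℝ (b k) y + ∑ k ∈ s, a k ^ 2 := by
  rw [norm_sub_sq_real, norm_sum_smul_sq hon, inner_sum]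
  congr 3
  exact Finset.sum_congr rfl fun k _ => by rw [inner_smul_right, real_inner_comm]

/-- The squared distance of `f` to the projection of `f + z` is the sum of a bias and a noise
energy. -/
lemma norm_sub_starProjection_sq [FiniteDimensional ℝ E] [Fintype ι]
    [DecidableEq ι] (hon : Orthonormal ℝ b)
    (s : Finset ι) (f z : E) :
    ‖f - (Submodule.span ℝ (b '' (s : Set ι))).starProjection (f + z)‖ ^ 2 =
      bias (‖f‖ ^ 2 - ∑ k, inner ℝ (b k) f ^ 2) (fun k => inner ℝ (b k) f) s +
        energy (fun k => inner ℝ (b k) z) s := by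
  rw [starProjection_span_image hon, norm_sub_sum_smul_sq hon]
  have h := Finset.sum_add_sum_compl s fun k => (inner ℝ (b k) f : ℝ) ^ 2
  simp only [bias, energy]
  rw [← h, Finset.mul_sum]
  have e : ∑ k ∈ s, (2 * (inner ℝ (b k) (f + z) * inner ℝ (b k) f)) =
      ∑ k ∈ s, (inner ℝ (b k) f : ℝ) ^ 2 + ∑ k ∈ s, (inner ℝ (b k) (f + z) : ℝ) ^ 2 -
        ∑ k ∈ s, (inner ℝ (b k) z : ℝ) ^ 2 := by
    rw [← Finset.sum_add_distrib, ← Finset.sum_sub_distrib]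
    refine Finset.sum_congr rfl fun k _ => ?_
    rw [inner_add_right]; ring
  linarith

lemma norm_self_sub_starProjection_sq [FiniteDimensional ℝ E] (hon : Orthonormal ℝ b)
    (s : Finset ι) (y : E) :
    ‖y - (Submodule.span ℝ (b '' (s : Set ι))).starProjection y‖ ^ 2 =
      ‖y‖ ^ 2 - ∑ k ∈ s, inner ℝ (b k) y ^ 2 := by
  rw [starProjection_span_image hon, norm_sub_sum_smul_sq hon]
  simp only [sq]
  ring

lemma norm_starProjection_sq [FiniteDimensional ℝ E] (hon : Orthonormal ℝ b)
    (s : Finset ι) (y : E) :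
    ‖(Submodule.span ℝ (b '' (s : Set ι))).starProjection y‖ ^ 2 =
      energy (fun k => inner ℝ (b k) y) s := by
  rw [starProjection_span_image hon, norm_sum_smul_sq hon, energy]

end Projection

/-! ### Excess of the noise energy on the bounded event, and its tail -/

section Excess

variable {Ω : Type*} [MeasurableSpace Ω] {P : Measure Ω} [IsProbabilityMeasure P] {n : ℕ}
  {σ c : ℝ} {ξ : Fin n → Ω → ℝ}

/-- The exponential moment of the noise energy in a subspace, on an event where the projected noise
is uniformly bounded. -/
lemma lintegral_exp_projection_le (hc : 0 ≤ c) (hξ : ∀ i, Measurable (ξ i)) (hind : iIndepFun ξ P)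
    (hb : ∀ i, BernsteinCondition P σ c (ξ i)) (S : Submodule ℝ (EuclideanSpace ℝ (Fin n)))
    {v r : ℝ} (hv : 0 < v) (hσv : σ ^ 2 ≤ v) (hr : 0 < r) (hrc : r * c ≤ 1 / 2) {A : Set Ω}
    (hA : MeasurableSet A) (hAr : ∀ ω ∈ A, ∀ i, |S.starProjection (noise ξ ω) i| ≤ 20 * v * r) :
    ∫⁻ ω in A, ENNReal.ofReal (Real.exp (‖S.starProjection (noise ξ ω)‖ ^ 2 / (80 * v))) ∂P ≤
      2 ^ Module.finrank ℝ S := by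
  have hmeas : Measurable (noise ξ) := measurable_noise hξ
  have hZ : Measurable fun ω => S.orthogonalProjectionOnto (noise ξ ω) :=
    S.orthogonalProjectionOnto.continuous.measurable.comp hmeas
  have hset : {t : S | ∀ i, |(t : EuclideanSpace ℝ (Fin n)) i| ≤ r / 2} =
      ⋂ i, {t : S | |(t : EuclideanSpace ℝ (Fin n)) i| ≤ r / 2} := by ext; simp
  have hcont : ∀ i, Continuous fun t : S => |(t : EuclideanSpace ℝ (Fin n)) i| := fun i => by
    fun_prop
  -- On `2B` the entries are at most `r`, within the sub-Gaussian range. Since `σ² ≤ v`, the value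
  -- `τ = 15v` is deliberately wasteful: it shrinks the shift to `Z/(40v)`, so that entries of `Z`
  -- up to `20vr` are allowed. The exponent becomes `3/(16τ) = 1/(80v)`.
  have h := lintegral_exp_norm_sq_le (P := P) hZ
    (B := {t : S | ∀ i, |(t : EuclideanSpace ℝ (Fin n)) i| ≤ r / 2}) ?_ ?_ ?_ ?_ (τ := 15 * v)
    (by positivity) ?_ (A := A) ?_ hA
  · refine le_trans (le_of_eq ?_) h
    congr 1 with ω
    congr 2
    rw [Submodule.starProjection_apply, Submodule.coe_norm]
    field_simp
    ring
  · intro x hx y hy α β hα hβ hαβ i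
    have e : ((α • x + β • y : S) : EuclideanSpace ℝ (Fin n)) i = α * (x : EuclideanSpace ℝ (Fin n)) i +
      β * (y : EuclideanSpace ℝ (Fin n)) i := by simp
    rw [e]
    calc _ ≤ |α * (x : EuclideanSpace ℝ (Fin n)) i| + |β * (y : EuclideanSpace ℝ (Fin n)) i| :=
          abs_add_le _ _
      _ ≤ α * (r / 2) + β * (r / 2) := by
          rw [abs_mul, abs_mul, abs_of_nonneg hα, abs_of_nonneg hβ]
          gcongr
          exacts [hx i, hy i]
      _ = r / 2 := by rw [← add_mul, hαβ, one_mul]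
  · rw [hset]
    exact MeasurableSet.iInter fun i => (isClosed_le (hcont i) continuous_const).measurableSet
  · rw [hset, Filter.iInter_mem]
    intro i
    refine Filter.mem_of_superset ((isOpen_lt (hcont i) continuous_const).mem_nhds ?_)
      fun t (ht : |(t : EuclideanSpace ℝ (Fin n)) i| < r / 2) => ht.le
    simp [hr]
  · refine (Metric.isBounded_iff_subset_closedBall 0).2 ⟨√(n * (r / 2) ^ 2), fun t ht => ?_⟩
    rw [mem_closedBall_zero_iff, Submodule.coe_norm, EuclideanSpace.norm_eq]
    refine Real.sqrt_le_sqrt ?_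
    calc _ ≤ ∑ _i : Fin n, (r / 2) ^ 2 := Finset.sum_le_sum fun i _ => by
            rw [Real.norm_eq_abs]; exact pow_le_pow_left₀ (abs_nonneg _) (ht i) 2
      _ = _ := by simp
  · intro t ht
    have hi : ∀ i, |((2 : ℝ) • (t : EuclideanSpace ℝ (Fin n))) i| * c ≤ 1 / 2 := fun i => by
      rw [PiLp.smul_apply, smul_eq_mul, abs_mul, abs_two]
      have := ht i
      calc _ ≤ r * c := by gcongr; linarith
        _ ≤ _ := hrc
    obtain ⟨h1, h2⟩ := integrable_exp_inner_noise hξ hind hb hi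
    have e : ∀ ω, inner ℝ ((2 : ℝ) • t) (S.orthogonalProjectionOnto (noise ξ ω)) =
        inner ℝ ((2 : ℝ) • (t : EuclideanSpace ℝ (Fin n))) (noise ξ ω) := fun ω => by
      rw [← Submodule.coe_smul, Submodule.inner_orthogonalProjectionOnto_eq_of_mem_left]
    simp only [e]
    rw [← ofReal_integral_eq_lintegral_ofReal h1 (ae_of_all _ fun ω => (Real.exp_pos _).le)]
    refine ENNReal.ofReal_le_ofReal (h2.trans (Real.exp_le_exp.2 ?_))
    rw [Submodule.coe_norm, Submodule.coe_smul]
    gcongr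
    linarith
  · intro ω hω i
    have := hAr ω hω i
    rw [Submodule.starProjection_apply] at this
    have e : (((3 / (8 * (15 * v))) • S.orthogonalProjectionOnto (noise ξ ω) : S) :
        EuclideanSpace ℝ (Fin n)) i = 1 / (40 * v) *
          (S.orthogonalProjectionOnto (noise ξ ω) : EuclideanSpace ℝ (Fin n)) i := by
      rw [Submodule.coe_smul, PiLp.smul_apply, smul_eq_mul]
      congr 1
      field_simp
      norm_num
    rw [e, abs_mul, abs_of_pos (by positivity)]
    calc _ ≤ 1 / (40 * v) * (20 * v * r) := by gcongr
      _ = r / 2 := by field_simp; norm_num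

lemma setIntegral_excess_le {P : Measure Ω} {W : Ω → ℝ} (hW : Measurable W) {v d : ℝ} (hv : 0 < v) (hd : 0 ≤ d)
    {D : ℕ} (hD : D = 0 → ∀ ω, W ω = 0) {A : Set Ω}
    (h : ∫⁻ ω in A, ENNReal.ofReal (Real.exp (W ω / (80 * v))) ∂P ≤ 2 ^ D) :
    ∫ ω in A, max (W ω - 324 * v * (D + d)) 0 ∂P ≤ 10 * v * Real.exp (-d) := by
  -- The final bound uses `(2e⁻⁴)^D ≤ 1/8`, which fails for `D = 0`; there the excess is identically
  -- zero.
  rcases Nat.eq_zero_or_pos D with h0 | hDpos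
  · have : ∀ ω, max (W ω - 324 * v * (D + d)) 0 = 0 := fun ω => by
      rw [hD h0 ω, h0]
      refine max_eq_right ?_
      have : 0 ≤ 324 * v * d := by positivity
      simpa using this
    simp only [this, integral_zero]
    positivity
  · have hm : Measurable fun ω => max (W ω - 324 * v * (D + d)) 0 :=
      (hW.sub_const _).max measurable_const
    have h0 : ∀ ω, 0 ≤ max (W ω - 324 * v * (D + d)) 0 := fun ω => le_max_right _ _
    rw [integral_eq_lintegral_of_nonneg_ae (ae_of_all _ h0) hm.aestronglyMeasurable]
    refine ENNReal.toReal_le_of_le_ofReal (by positivity) ?_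
    have hpt : ∀ ω, ENNReal.ofReal (max (W ω - 324 * v * (D + d)) 0) ≤
        ENNReal.ofReal (80 * v * Real.exp (-(4 * (D + d)))) *
          ENNReal.ofReal (Real.exp (W ω / (80 * v))) := fun ω => by
      rw [← ENNReal.ofReal_mul (by positivity)]
      refine ENNReal.ofReal_le_ofReal (max_le ?_ (by positivity))
      rw [mul_assoc (80 * v), ← Real.exp_add]
      -- Linearizing the exponential at level `320 v (D+d)`, below the threshold `324 v (D+d)`,
      -- leaves `e^{-4D}` to beat the factor `2^D`.
      have h1 := Real.add_one_le_exp (-(4 * (D + d)) + W ω / (80 * v))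
      have h2 : 80 * v * (-(4 * (D + d)) + W ω / (80 * v)) = W ω - 320 * v * (D + d) := by
        field_simp; ring
      have h3 : 0 ≤ v * (D + d) := by positivity
      calc _ ≤ 80 * v * (-(4 * (D + d)) + W ω / (80 * v)) := by rw [h2]; linarith
        _ ≤ _ := by gcongr; linarith
    calc _ ≤ ∫⁻ ω in A, ENNReal.ofReal (80 * v * Real.exp (-(4 * (D + d)))) *
          ENNReal.ofReal (Real.exp (W ω / (80 * v))) ∂P := lintegral_mono hpt
      _ ≤ ENNReal.ofReal (80 * v * Real.exp (-(4 * (D + d)))) * 2 ^ D := by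
          rw [lintegral_const_mul _ (by fun_prop)]
          gcongr
      _ = ENNReal.ofReal (80 * v * Real.exp (-(4 * (D + d))) * 2 ^ D) := by
          rw [ENNReal.ofReal_mul (q := 2 ^ D) (by positivity), ENNReal.ofReal_pow zero_le_two,
            ENNReal.ofReal_ofNat]
      _ ≤ _ := by
          refine ENNReal.ofReal_le_ofReal ?_
          have e4 : Real.exp (-4) ≤ 1 / 16 := by
            have h1 := Real.add_one_le_exp (1 : ℝ)
            have h2 : Real.exp 4 = Real.exp 1 ^ 4 := by rw [← Real.exp_nat_mul]; norm_num
            rw [Real.exp_neg, ← one_div, h2]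
            refine one_div_le_one_div_of_le (by norm_num) ?_
            calc (16 : ℝ) = 2 ^ 4 := by norm_num
              _ ≤ _ := by gcongr; linarith
          have e1 : Real.exp (-(4 * (D + d))) * 2 ^ D = (Real.exp (-4) * 2) ^ D * Real.exp (-(4 * d)) := by
            rw [mul_pow, ← Real.exp_nat_mul, mul_right_comm, ← Real.exp_add]
            ring_nf
          have e2 : (Real.exp (-4) * 2) ^ D ≤ 1 / 8 := by
            refine (pow_le_of_le_one (by positivity) (by linarith) hDpos.ne').trans (by linarith)
          have e3 : Real.exp (-(4 * d)) ≤ Real.exp (-d) := Real.exp_le_exp.2 (by linarith)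
          calc _ = 80 * v * ((Real.exp (-4) * 2) ^ D * Real.exp (-(4 * d))) := by rw [mul_assoc, e1]
            _ ≤ 80 * v * (1 / 8 * Real.exp (-d)) := by gcongr
            _ = _ := by ring

/-- The square is absorbed by `exp(l|x|/2)`; the other half of the exponential is at least `exp(l
x₀/2)` beyond the threshold. -/
lemma sq_le_of_lt_abs {x x₀ l : ℝ} (hl : 0 < l) (hx : x₀ < |x|) :
    x ^ 2 ≤ 8 / l ^ 2 * Real.exp (-(l * x₀ / 2)) * (Real.exp (l * x) + Real.exp (-l * x)) := by
  have h0 : 0 ≤ l * |x| / 2 := by positivity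
  have h1 : (l * |x| / 2) ^ 2 / 2 ≤ Real.exp (l * |x| / 2) := by
    have := Real.quadratic_le_exp_of_nonneg h0
    linarith
  have h2 : Real.exp (l * |x| / 2) ≤ Real.exp (-(l * x₀ / 2)) * Real.exp (l * |x|) := by
    rw [← Real.exp_add]
    refine Real.exp_le_exp.2 ?_
    nlinarith
  have h3 : Real.exp (l * |x|) ≤ Real.exp (l * x) + Real.exp (-l * x) := by
    rcases abs_cases x with ⟨h, -⟩ | ⟨h, -⟩ <;> rw [h]
    · linarith [Real.exp_pos (-l * x)]
    · rw [mul_neg, ← neg_mul]; linarith [Real.exp_pos (l * x)]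
  have h4 : x ^ 2 = 8 / l ^ 2 * ((l * |x| / 2) ^ 2 / 2) := by
    rw [← sq_abs x]; field_simp; norm_num
  calc x ^ 2 = 8 / l ^ 2 * ((l * |x| / 2) ^ 2 / 2) := h4
    _ ≤ 8 / l ^ 2 * (Real.exp (-(l * x₀ / 2)) * (Real.exp (l * x) + Real.exp (-l * x))) := by
        gcongr; exact h1.trans (h2.trans (by gcongr))
    _ = _ := by ring

lemma energy_univ_le_of_lt_abs {ι : Type*} [Fintype ι] (x : ι → ℝ) {x₀ l : ℝ} (hl : 0 < l)
    (h : ∃ k, x₀ < |x k|) :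
    energy x Finset.univ ≤ Fintype.card ι * ∑ k, 8 / l ^ 2 * Real.exp (-(l * x₀ / 2)) *
      (Real.exp (l * x k) + Real.exp (-l * x k)) := by
  obtain ⟨k₀, hk₀⟩ := h
  -- Only the largest coordinate is known to exceed `x₀` along with `k₀`, so the energy is first
  -- bounded by `card ι` times its square.
  obtain ⟨k₁, -, hk₁⟩ := Finset.exists_max_image Finset.univ (fun k => |x k|) ⟨k₀, Finset.mem_univ _⟩
  have h1 : energy x Finset.univ ≤ Fintype.card ι * x k₁ ^ 2 := by
    simp only [energy, Fintype.card, ← nsmul_eq_mul]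
    exact Finset.sum_le_card_nsmul _ _ _ fun k hk => sq_le_sq.2 (hk₁ k hk)
  refine h1.trans (mul_le_mul_of_nonneg_left ?_ (Nat.cast_nonneg _))
  refine (sq_le_of_lt_abs hl (hk₀.trans_le (hk₁ k₀ (Finset.mem_univ _)))).trans ?_
  exact Finset.single_le_sum (f := fun k => 8 / l ^ 2 * Real.exp (-(l * x₀ / 2)) *
    (Real.exp (l * x k) + Real.exp (-l * x k))) (fun k _ => by positivity) (Finset.mem_univ k₁)

end Excess

/-! ### Uniform control of the noise energy over the models -/

section NoiseControl

variable {Ω : Type*} [MeasurableSpace Ω] {P : Measure Ω} [IsProbabilityMeasure P] {n : ℕ}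
  {σ c : ℝ} {ξ : Fin n → Ω → ℝ}

lemma integrable_exp_mul_inner_noise (hξ : ∀ i, Measurable (ξ i)) (hind : iIndepFun ξ P)
    (hB : ∀ i, BernsteinCondition P σ c (ξ i)) (hc : 0 ≤ c) {x : EuclideanSpace ℝ (Fin n)}
    (hx : ‖x‖ = 1) {u : ℝ} (hu : |u| * c ≤ 1 / 2) :
    Integrable (fun ω => Real.exp (u * inner ℝ x (noise ξ ω))) P ∧
      ∫ ω, Real.exp (u * inner ℝ x (noise ξ ω)) ∂P ≤ Real.exp (σ ^ 2 * u ^ 2) := by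
  have h := integrable_exp_inner_noise hξ hind hB (t := u • x) fun i => by
    rw [PiLp.smul_apply, smul_eq_mul, abs_mul]
    refine le_trans ?_ hu
    gcongr
    exact mul_le_of_le_one_right (abs_nonneg _) (hx ▸ abs_apply_le_norm x i)
  simpa only [inner_smul_left, conj_trivial, norm_smul, hx, mul_one, Real.norm_eq_abs, sq_abs]
    using h

lemma exists_small_scale (hσ : 0 ≤ σ) (hc : 0 ≤ c) :
    ∃ l : ℝ, 0 < l ∧ l * c ≤ 1 / 2 ∧ σ ^ 2 * l ^ 2 ≤ 1 := by
  -- The added `1` keeps the scale finite when `c = σ = 0`.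
  refine ⟨1 / (2 * (c + σ) + 1), by positivity, ?_, ?_⟩
  · rw [div_mul_eq_mul_div, div_le_iff₀ (by positivity)]
    linarith
  · rw [← mul_pow]
    refine pow_le_one₀ (by positivity) ?_
    rw [mul_one_div, div_le_one (by positivity)]
    linarith

lemma integral_inner_noise_sq_le (hξ : ∀ i, Measurable (ξ i)) (hind : iIndepFun ξ P)
    (hB : ∀ i, BernsteinCondition P σ c (ξ i)) (hσ : 0 ≤ σ) (hc : 0 ≤ c)
    {x : EuclideanSpace ℝ (Fin n)} (hx : ‖x‖ = 1) :
    Integrable (fun ω => inner ℝ x (noise ξ ω) ^ 2) P ∧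
      ∫ ω, inner ℝ x (noise ξ ω) ^ 2 ∂P ≤ 4 * σ ^ 2 := by
  obtain ⟨l, hl, hlc, hls⟩ := exists_small_scale hσ hc
  have hm := measurable_noise hξ
  exact integral_sq_le_of_exp_le (by fun_prop) hl hls fun u hu =>
    integrable_exp_mul_inner_noise hξ hind hB hc hx
      (le_trans (mul_le_mul_of_nonneg_right hu hc) hlc)

lemma integrable_of_bernstein {X : Ω → ℝ} (hX : Measurable X) (hσ : 0 ≤ σ) (hc : 0 ≤ c)
    (hB : BernsteinCondition P σ c X) : Integrable X P := by
  obtain ⟨l, hl, hlc, hls⟩ := exists_small_scale hσ hc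
  have h := (integral_sq_le_of_exp_le (P := P) hX hl hls fun u hu => by
    have h1 : |u| * c ≤ 1 / 2 := le_trans (mul_le_mul_of_nonneg_right hu hc) hlc
    exact ⟨(hB u (by linarith)).1, hB.integral_exp_le h1⟩).1
  exact ((memLp_two_iff_integrable_sq hX.aestronglyMeasurable).2 h).integrable one_le_two

lemma integral_inner_noise {P : Measure Ω} (hξi : ∀ i, Integrable (ξ i) P) (hξ0 : ∀ i, ∫ ω, ξ i ω ∂P = 0)
    (x : EuclideanSpace ℝ (Fin n)) :
    Integrable (fun ω => inner ℝ x (noise ξ ω)) P ∧ ∫ ω, inner ℝ x (noise ξ ω) ∂P = 0 := by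
  simp only [inner_noise]
  refine ⟨integrable_finsetSum _ fun i _ => (hξi i).const_mul _, ?_⟩
  rw [integral_finsetSum _ fun i _ => (hξi i).const_mul _]
  exact Finset.sum_eq_zero fun i _ => by rw [integral_const_mul, hξ0, mul_zero]

lemma varFactor_ge (hσ : 0 ≤ σ) (hc : 0 ≤ c) {a b : ℝ} (ha : 0 < a) (hb : 0 < b) :
    σ ^ 2 ≤ varFactor σ c a b ∧ 4 * c * (c + σ) * (b + 2) / a ≤ varFactor σ c a b := by
  unfold varFactor
  have : 0 ≤ 4 * c * (c + σ) * (b + 2) / a := by positivity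
  constructor <;> nlinarith [sq_nonneg σ]

/-- The integral of the noise energy off the event where all the coordinates are small. -/
lemma setIntegral_energy_le {P : Measure Ω} {ι : Type*} [Fintype ι] {x : ι → Ω → ℝ}
    {l x₀ w : ℝ} (hl : 0 < l)
    (hp : ∀ k, Integrable (fun ω => Real.exp (l * x k ω)) P ∧
      ∫ ω, Real.exp (l * x k ω) ∂P ≤ w)
    (hm : ∀ k, Integrable (fun ω => Real.exp (-l * x k ω)) P ∧
      ∫ ω, Real.exp (-l * x k ω) ∂P ≤ w)
    {A : Set Ω} (hA : MeasurableSet A) (hAx : ∀ ω ∈ A, ∃ k, x₀ < |x k ω|) :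
    ∫ ω in A, energy (fun k => x k ω) Finset.univ ∂P ≤
      (Fintype.card ι : ℝ) ^ 2 * (8 / l ^ 2 * Real.exp (-(l * x₀ / 2)) * (2 * w)) := by
  set C := 8 / l ^ 2 * Real.exp (-(l * x₀ / 2)) with hC
  have hC0 : 0 ≤ C := by positivity
  have hk : ∀ k, Integrable (fun ω => C * (Real.exp (l * x k ω) + Real.exp (-l * x k ω))) P :=
    fun k => ((hp k).1.add (hm k).1).const_mul C
  have hi : Integrable (fun ω => (Fintype.card ι : ℝ) *
      ∑ k, C * (Real.exp (l * x k ω) + Real.exp (-l * x k ω))) P :=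
    (integrable_finsetSum _ fun k _ => hk k).const_mul _
  calc _ ≤ ∫ ω in A, (Fintype.card ι : ℝ) *
        ∑ k, C * (Real.exp (l * x k ω) + Real.exp (-l * x k ω)) ∂P := by
        refine integral_mono_of_nonneg (ae_of_all _ fun ω => energy_nonneg _ _) hi.integrableOn ?_
        exact (ae_restrict_iff' hA).2 (ae_of_all _ fun ω hω =>
          energy_univ_le_of_lt_abs _ hl (hAx ω hω))
    _ ≤ ∫ ω, (Fintype.card ι : ℝ) *
        ∑ k, C * (Real.exp (l * x k ω) + Real.exp (-l * x k ω)) ∂P :=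
        setIntegral_le_integral hi (ae_of_all _ fun ω => by positivity)
    _ = (Fintype.card ι : ℝ) * ∑ k, C * (∫ ω, Real.exp (l * x k ω) ∂P +
        ∫ ω, Real.exp (-l * x k ω) ∂P) := by
        rw [integral_const_mul, integral_finsetSum _ fun k _ => hk k]
        congr 1
        refine Finset.sum_congr rfl fun k _ => ?_
        rw [integral_const_mul]
        congr 1
        exact integral_add (hp k).1 (hm k).1
    _ ≤ (Fintype.card ι : ℝ) * ∑ _k : ι, C * (2 * w) := by
        gcongr with k _
        linarith [(hp k).2, (hm k).2]
    _ = _ := by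
        rw [Finset.sum_const, nsmul_eq_mul, Finset.card_univ]
        ring

lemma tail_constant_le {n : ℕ} (hn : 2 ≤ n) {a b s d N : ℝ} (ha : 0 < a) (hb : 0 < b) (hs : 0 < s)
    (hN : 1 ≤ N) (hNn : N ≤ √(n : ℝ) / (a * Real.log n)) (hd0 : 0 ≤ d) (hdN : d ≤ N) (hdn : d ≤ n) :
    15 * (d ^ 2 * (8 / (1 / (2 * s)) ^ 2 *
      Real.exp (-(1 / (2 * s) * (20 * s * (b + 2) * Real.log n) / 2)) * (2 * Real.exp (1 / 4)))) ≤
      4 * (b + 2) ^ 2 * s ^ 2 / (a ^ 2 * N * (n : ℝ) ^ b) := by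
  have hn0 : (0 : ℝ) < n := by positivity
  have hn2 : (2 : ℝ) ≤ n := by exact_mod_cast hn
  have hlog2 : Real.log 2 ≤ Real.log n := Real.log_le_log two_pos hn2
  have hl2 := Real.log_two_gt_d9
  have hL0 : 0 < Real.log n := by linarith
  set y := (b + 2) * Real.log n with hy
  have hy2 : 2 * Real.log 2 ≤ y := by rw [hy]; gcongr; linarith
  have e1 : -(1 / (2 * s) * (20 * s * (b + 2) * Real.log n) / 2) = -(5 * y) := by
    rw [hy]; field_simp; norm_num
  have e2 : 8 / (1 / (2 * s)) ^ 2 = 32 * s ^ 2 := by field_simp; norm_num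
  have hquarter : Real.exp (1 / 4) ≤ 1.3 := by
    have := Real.exp_bound' (x := 1 / 4) (by norm_num) (by norm_num) (n := 3) (by norm_num)
    refine this.trans ?_
    norm_num [Finset.sum_range_succ, Nat.factorial]
  have hNL : N * (a * Real.log n) ≤ √n := (le_div_iff₀ (by positivity)).1 hNn
  have hsq : N ^ 2 * a ^ 2 * Real.log n ^ 2 ≤ n := by
    have := pow_le_pow_left₀ (by positivity) hNL 2
    rw [Real.sq_sqrt hn0.le] at this
    linarith
  -- Aliasing keeps the number of coordinates below `n` even when `N` exceeds `n`, so one factor `d`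
  -- is traded for `N` and the other for `n`.
  have hd2 : d ^ 2 ≤ N * n := by nlinarith
  have hpow : (n : ℝ) ^ b * (n : ℝ) ^ 2 = Real.exp y := by
    rw [← Real.rpow_two, ← Real.rpow_add hn0, Real.rpow_def_of_pos hn0, hy, mul_comm]
  have h256 : Real.exp (-(4 * y)) ≤ 1 / 256 := by
    have : Real.log (1 / 256) = -(8 * Real.log 2) := by
      rw [one_div, Real.log_inv, show (256 : ℝ) = 2 ^ 8 by norm_num, Real.log_pow]; norm_num
    rw [← Real.le_log_iff_exp_le (by norm_num), this]
    linarith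
  have hnb : 0 < (n : ℝ) ^ b := Real.rpow_pos_of_pos hn0 b
  rw [e1, e2, le_div_iff₀ (by positivity)]
  have hL2 : 0 < Real.log n ^ 2 := by positivity
  refine le_of_mul_le_mul_right ?_ hL2
  -- With `y = (b+2) log n`, polynomial factors cost only `exp y = n^{b+2}` out of the available
  -- `exp(-5y)`; the surplus `exp(-4y)` absorbs the numerical constants.
  have hmain : d ^ 2 * (a ^ 2 * N * (n : ℝ) ^ b) * Real.log n ^ 2 ≤ Real.exp y := by
    calc _ ≤ (N * n) * (a ^ 2 * N * (n : ℝ) ^ b) * Real.log n ^ 2 := by gcongr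
      _ = n * (n : ℝ) ^ b * (N ^ 2 * a ^ 2 * Real.log n ^ 2) := by ring
      _ ≤ n * (n : ℝ) ^ b * n := by gcongr
      _ = (n : ℝ) ^ b * (n : ℝ) ^ 2 := by ring
      _ = _ := hpow
  calc _ = 15 * 64 * Real.exp (1 / 4) * s ^ 2 * Real.exp (-(5 * y)) *
        (d ^ 2 * (a ^ 2 * N * (n : ℝ) ^ b) * Real.log n ^ 2) := by ring
    _ ≤ 15 * 64 * 1.3 * s ^ 2 * Real.exp (-(5 * y)) * Real.exp y := by gcongr
    _ = 15 * 64 * 1.3 * s ^ 2 * Real.exp (-(4 * y)) := by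
        rw [mul_assoc _ (Real.exp _), ← Real.exp_add]; ring_nf
    _ ≤ 15 * 64 * 1.3 * s ^ 2 * (1 / 256) := by gcongr
    _ ≤ 4 * y ^ 2 * s ^ 2 := by
        have : 1.9 ≤ y ^ 2 := by nlinarith
        nlinarith [sq_nonneg s]
    _ = _ := by rw [hy]; ring

/-- This is what the second term of the variance factor is for: with `r = 1/(2c)`, the edge of the
sub-Gaussian range, the sup-norm bound reads `40(c+σ)(b+2)/a ≤ 10v/c`. For `c = 0` every radius is
allowed and a large one is taken. -/
lemma exists_radius (hσ : 0 ≤ σ) (hc : 0 ≤ c) {a b v s N : ℝ} {n : ℕ} (hn : 2 ≤ n) (ha : 0 < a)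
    (hb : 0 < b) (hv : 0 < v) (hs : s = c + σ) (hvc : 4 * c * (c + σ) * (b + 2) / a ≤ v)
    (hNn : N ≤ √(n : ℝ) / (a * Real.log n)) :
    ∃ r : ℝ, 0 < r ∧ r * c ≤ 1 / 2 ∧
      N * (20 * s * (b + 2) * Real.log n) * √(2 / n) ≤ 20 * v * r := by
  rcases hc.eq_or_lt with rfl | hc
  · refine ⟨|N * (20 * s * (b + 2) * Real.log n) * √(2 / n)| / (20 * v) + 1, by positivity, by simp, ?_⟩
    have e : 20 * v * (|N * (20 * s * (b + 2) * Real.log n) * √(2 / n)| / (20 * v) + 1) =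
      |N * (20 * s * (b + 2) * Real.log n) * √(2 / n)| + 20 * v := by field_simp
    rw [e]
    exact (le_abs_self _).trans (by linarith)
  · refine ⟨1 / (2 * c), by positivity, by field_simp; rfl, ?_⟩
    have hn0 : (0 : ℝ) < n := by positivity
    have hL0 : 0 < Real.log n := Real.log_pos (by exact_mod_cast hn)
    have hs0 : 0 < s := by rw [hs]; positivity
    have hNL : N * (a * Real.log n) ≤ √n := (le_div_iff₀ (by positivity)).1 hNn
    have h2 : √(2 : ℝ) ≤ 2 := by
      rw [Real.sqrt_le_left two_pos.le]; norm_num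
    rw [Real.sqrt_div zero_le_two]
    calc _ = 20 * s * (b + 2) / a * (N * (a * Real.log n)) * (√2 / √n) := by field_simp
      _ ≤ 20 * s * (b + 2) / a * √n * (2 / √n) := by gcongr
      _ = 10 / c * (4 * c * s * (b + 2) / a) := by field_simp; norm_num
      _ ≤ 10 / c * v := by rw [hs]; gcongr
      _ = _ := by field_simp; norm_num

variable {ι : Type*} [Fintype ι] {e : ι → EuclideanSpace ℝ (Fin n)} {α : Type*} {M : Finset α}
  {s : α → Finset ι} {Δ : α → ℝ} {a b : ℝ} {D : ℕ}

/-- A control of the noise energy in excess of the penalty, uniformly over the models. -/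
lemma exists_excess (hn : 2 ≤ n) (hσ : 0 ≤ σ) (hc : 0 ≤ c) (hξ : ∀ i, Measurable (ξ i))
    (hind : iIndepFun ξ P) (hB : ∀ i, BernsteinCondition P σ c (ξ i)) (hon : Orthonormal ℝ e)
    (he : ∀ k i, |e k i| ≤ √(2 / n)) (hcN : Fintype.card ι ≤ 2 * D + 1)
    (hcn : Fintype.card ι ≤ n) (hΔ : ∀ m ∈ M, 0 ≤ Δ m) (ha : 0 < a) (hb : 0 < b)
    (hD : 2 * (D : ℝ) + 1 ≤ √(n : ℝ) / (a * Real.log n)) :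
    ∃ T : Ω → ℝ, Integrable T P ∧ (∀ ω, 0 ≤ T ω) ∧
      (∀ m ∈ M, ∀ ω, energy (fun k => inner ℝ (e k) (noise ξ ω)) (s m) ≤
        324 * varFactor σ c a b * ((s m).card + Δ m) + T ω) ∧
      15 * ∫ ω, T ω ∂P ≤ 324 * varFactor σ c a b * (∑ m ∈ M, Real.exp (-Δ m)) +
        4 * (b + 2) ^ 2 * (c + σ) ^ 2 / (a ^ 2 * (2 * (D : ℝ) + 1) * (n : ℝ) ^ b) := by
  obtain ⟨hvσ, hvc⟩ := varFactor_ge hσ hc ha hb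
  set v := varFactor σ c a b with hvdef
  have hnoise := measurable_noise hξ
  have hxm : ∀ k, Measurable fun ω => (inner ℝ (e k) (noise ξ ω) : ℝ) := fun k => by fun_prop
  have hx2 := fun k => integral_inner_noise_sq_le hξ hind hB hσ hc (hon.1 k)
  have hT2 : Integrable (fun ω => energy (fun k => inner ℝ (e k) (noise ξ ω)) Finset.univ) P :=
    integrable_energy (fun k => (hx2 k).1) _
  have hsub : ∀ (m : α) ω, energy (fun k => inner ℝ (e k) (noise ξ ω)) (s m) ≤
      energy (fun k => inner ℝ (e k) (noise ξ ω)) Finset.univ := fun m ω =>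
    Finset.sum_le_sum_of_subset_of_nonneg (Finset.subset_univ _) fun _ _ _ => sq_nonneg _
  have hv0 : 0 ≤ v := le_trans (sq_nonneg σ) hvσ
  rcases hv0.eq_or_lt with hv | hv
  · have hσ0 : σ ^ 2 = 0 := le_antisymm (hvσ.trans hv.symm.le) (sq_nonneg _)
    refine ⟨_, hT2, fun ω => energy_nonneg _ _, fun m _ ω => by simpa [← hv] using hsub m ω, ?_⟩
    have h1 := integral_energy_le (fun k => (hx2 k).1) (fun k => (hx2 k).2) Finset.univ
    rw [hσ0] at h1
    have h2 : 0 ≤ 4 * (b + 2) ^ 2 * (c + σ) ^ 2 / (a ^ 2 * (2 * (D : ℝ) + 1) * (n : ℝ) ^ b) := by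
      positivity
    rw [← hv]
    linarith
  · have hs : 0 < c + σ := by
      by_contra hs
      have hc0 : c = 0 := by linarith
      have hσ0 : σ = 0 := by linarith
      simp [hvdef, varFactor, hc0, hσ0] at hv
    -- With the exponential scale `1/(2(c+σ))`, this threshold yields the tail factor `exp(-5(b+2)
    -- log n)`.
    set x₀ := 20 * (c + σ) * (b + 2) * Real.log n with hx₀
    have hL0 : 0 < Real.log n := Real.log_pos (by exact_mod_cast hn)
    obtain ⟨r, hr0, hrc, hr⟩ := exists_radius hσ hc hn ha hb hv rfl hvc hD
    set A : Set Ω := {ω | ∀ k, |(inner ℝ (e k) (noise ξ ω) : ℝ)| ≤ x₀} with hAdef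
    have hA : MeasurableSet A := by
      have : A = ⋂ k, {ω | |(inner ℝ (e k) (noise ξ ω) : ℝ)| ≤ x₀} := by ext; simp [hAdef]
      rw [this]
      exact MeasurableSet.iInter fun k => measurableSet_le (by fun_prop) measurable_const
    have hWm : ∀ t : Finset ι, Measurable fun ω => energy (fun k => inner ℝ (e k) (noise ξ ω)) t :=
      fun t => by unfold energy; fun_prop
    have hchi : ∀ m ∈ M, ∫ ω in A, max (energy (fun k => inner ℝ (e k) (noise ξ ω)) (s m) -
        324 * v * ((s m).card + Δ m)) 0 ∂P ≤ 10 * v * Real.exp (-Δ m) := fun m hm => by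
      refine setIntegral_excess_le (hWm _) hv (hΔ m hm) (fun h0 ω => ?_) ?_
      · rw [Finset.card_eq_zero.1 h0]; simp [energy]
      · have h := lintegral_exp_projection_le hc hξ hind hB
          (Submodule.span ℝ (e '' (s m : Set ι))) hv hvσ hr0 hrc hA (fun ω hω i => ?_)
        · simpa only [norm_starProjection_sq hon, finrank_span_image hon] using h
        · rw [starProjection_span_image hon]
          have hcard : ((s m).card : ℝ) ≤ 2 * D + 1 := by
            exact_mod_cast (Finset.card_le_univ _).trans hcN
          calc |(∑ k ∈ s m, (inner ℝ (e k) (noise ξ ω) : ℝ) • e k) i|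
              = |∑ k ∈ s m, (inner ℝ (e k) (noise ξ ω) : ℝ) * e k i| := by
                simp [Finset.sum_apply]
            _ ≤ ∑ k ∈ s m, |(inner ℝ (e k) (noise ξ ω) : ℝ) * e k i| :=
                Finset.abs_sum_le_sum_abs _ _
            _ ≤ ∑ _k ∈ s m, x₀ * √(2 / n) := Finset.sum_le_sum fun k _ => by
                rw [abs_mul]
                exact mul_le_mul (hω k) (he k i) (abs_nonneg _) (by positivity)
            _ = (s m).card * x₀ * √(2 / n) := by rw [Finset.sum_const, nsmul_eq_mul]; ring
            _ ≤ (2 * D + 1) * x₀ * √(2 / n) := by gcongr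
            _ ≤ _ := hr
    have hexp : ∀ (k : ι) (u : ℝ), |u| = 1 / (2 * (c + σ)) →
        Integrable (fun ω => Real.exp (u * inner ℝ (e k) (noise ξ ω))) P ∧
          ∫ ω, Real.exp (u * inner ℝ (e k) (noise ξ ω)) ∂P ≤ Real.exp (1 / 4) := fun k u hu => by
      have h := integrable_exp_mul_inner_noise hξ hind hB hc (hon.1 k) (u := u) (by
        rw [hu, div_mul_eq_mul_div, div_le_iff₀ (by positivity)]; linarith)
      refine ⟨h.1, h.2.trans (Real.exp_le_exp.2 ?_)⟩
      rw [← sq_abs u, hu, div_pow, ← mul_div_assoc, div_le_iff₀ (by positivity)]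
      nlinarith [mul_nonneg hc hσ]
    have habs : |1 / (2 * (c + σ))| = 1 / (2 * (c + σ)) := abs_of_pos (by positivity)
    have htail := setIntegral_energy_le (x := fun k ω => inner ℝ (e k) (noise ξ ω)) (l := 1 / (2 * (c + σ))) (x₀ := x₀) (by positivity)
      (fun k => hexp k _ habs) (fun k => hexp k _ (by rw [abs_neg, habs])) hA.compl
      (fun ω hω => by simpa [hAdef] using hω)
    have hconst := tail_constant_le hn ha hb hs (N := 2 * D + 1) (d := Fintype.card ι)
      (by linarith [Nat.cast_nonneg (α := ℝ) D]) hD (Nat.cast_nonneg _) (by exact_mod_cast hcN)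
      (by exact_mod_cast hcn)
    set g : α → Ω → ℝ := fun m ω => max (energy (fun k => inner ℝ (e k) (noise ξ ω)) (s m) -
        324 * v * ((s m).card + Δ m)) 0 with hg
    have hg0 : ∀ m ω, 0 ≤ g m ω := fun m ω => le_max_right _ _
    have hgi : ∀ m ∈ M, Integrable (g m) P := fun m hm =>
      ((integrable_energy (fun k => (hx2 k).1) (s m)).sub (integrable_const _)).pos_part
    have hT1 : Integrable (fun ω => ∑ m ∈ M, A.indicator (g m) ω) P :=
      integrable_finsetSum _ fun m hm => (hgi m hm).indicator hA
    have hT3 := hT2.indicator hA.compl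
    -- On `A` the variable `T` is the sum over models of the positive excesses; off `A` it is the
    -- whole noise energy.
    refine ⟨_, hT1.add hT3, fun ω => add_nonneg (Finset.sum_nonneg fun m _ =>
      Set.indicator_nonneg (fun ω _ => hg0 m ω) ω)
      (Set.indicator_nonneg (fun ω _ => energy_nonneg _ _) ω), fun m hm ω => ?_, ?_⟩
    · by_cases hω : ω ∈ A
      · have h1 : g m ω ≤ ∑ m ∈ M, A.indicator (g m) ω := by
          simp only [Set.indicator_of_mem hω]
          exact Finset.single_le_sum (f := fun m => g m ω) (fun m _ => hg0 m ω) hm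
        have h2 := le_max_left (energy (fun k => inner ℝ (e k) (noise ξ ω)) (s m) -
          324 * v * ((s m).card + Δ m)) 0
        rw [Pi.add_apply, Set.indicator_of_notMem (s := Aᶜ) (by simpa using hω), add_zero]
        simp only [hg] at h1
        simp only [hg]
        linarith
      · rw [Pi.add_apply, Set.indicator_of_mem (s := Aᶜ) hω]
        simp only [Set.indicator_of_notMem hω, Finset.sum_const_zero, zero_add]
        have : 0 ≤ 324 * v * ((s m).card + Δ m) :=
          mul_nonneg (by positivity) (add_nonneg (Nat.cast_nonneg _) (hΔ m hm))
        linarith [hsub m ω]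
    · rw [integral_add' hT1 hT3, integral_finsetSum _ fun m hm => (hgi m hm).indicator hA,
        integral_indicator hA.compl]
      simp only [integral_indicator hA]
      -- The factor `15` of the oracle inequality turns `10 * v` into `150 * v`, below the allotted
      -- `324 * v`.
      have h1 : ∑ m ∈ M, ∫ ω in A, g m ω ∂P ≤ 10 * v * ∑ m ∈ M, Real.exp (-Δ m) := by
        rw [Finset.mul_sum]; exact Finset.sum_le_sum hchi
      have h2 : 0 ≤ v * ∑ m ∈ M, Real.exp (-Δ m) := by positivity
      linarith

end NoiseControl

end TrigSelection

/-! ### Assembly of the oracle inequality -/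

theorem mainTheorem7
    {Ω : Type*} [MeasurableSpace Ω] (P : Measure Ω) [IsProbabilityMeasure P]
    (n : ℕ) (hn : 2 ≤ n) (D : ℕ)
    (σ c : ℝ) (hσ : 0 ≤ σ) (hc : 0 ≤ c)
    -- the unknown function and the noise
    (F : ℝ → ℝ) (ξ : Fin n → Ω → ℝ)
    (hξ_meas : ∀ i, Measurable (ξ i))
    (hξ_indep : iIndepFun ξ P)
    (hξ_centered : ∀ i, ∫ ω, ξ i ω ∂P = 0)
    (hξ_bernstein : ∀ i, TrigSelection.BernsteinCondition P σ c (ξ i))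
    -- the collection of models and the weights
    (M : Finset (Finset ℕ)) (hM : ∀ m ∈ M, m ⊆ Finset.range (2 * D + 1))
    (Δ : Finset ℕ → ℝ) (hΔ : ∀ m ∈ M, 0 ≤ Δ m)
    (a b : ℝ) (ha : 0 < a) (hb : 0 < b)
    (hD : 2 * (D : ℝ) + 1 ≤ √(n : ℝ) / (a * Real.log n))
    (K : ℝ) (hK : 1 < K)
    (pen : Finset ℕ → ℝ)
    (hpen : ∀ m ∈ M, K * TrigSelection.kappa ^ 2 * TrigSelection.varFactor σ c a b *
      ((TrigSelection.modelDim n m : ℝ) + Δ m) ≤ pen m)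
    -- the selected index: any (measurable) minimizer of the criterion
    (mhat : Ω → Finset ℕ)
    (hmhat_meas : ∀ m, MeasurableSet {ω | mhat ω = m})
    (hmhat_mem : ∀ ω, mhat ω ∈ M)
    (hmhat_min : ∀ ω, ∀ m ∈ M,
      TrigSelection.crit pen (TrigSelection.obs F ξ ω) (mhat ω) ≤
        TrigSelection.crit pen (TrigSelection.obs F ξ ω) m) :
    (∀ m ∈ M, Integrable (fun ω =>
      ‖TrigSelection.signal n F - TrigSelection.lse m (TrigSelection.obs F ξ ω)‖ ^ 2) P) ∧
    Integrable (fun ω =>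
      ‖TrigSelection.signal n F - TrigSelection.lse (mhat ω) (TrigSelection.obs F ξ ω)‖ ^ 2) P ∧
    ∫ ω, ‖TrigSelection.signal n F -
        TrigSelection.lse (mhat ω) (TrigSelection.obs F ξ ω)‖ ^ 2 ∂P ≤
      TrigSelection.oracleConst K *
        ((⨅ m : {m : Finset ℕ // m ∈ M},
            (∫ ω, ‖TrigSelection.signal n F -
                TrigSelection.lse m.1 (TrigSelection.obs F ξ ω)‖ ^ 2 ∂P + pen m.1)) +
          TrigSelection.remainder n D M Δ σ c a b) := by
  classical
  have hn0 : 0 < n := by lia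
  obtain ⟨e, hcN, hcn, hon, he, hspan⟩ := TrigSelection.exists_trigBasis hn0 (2 * D + 1)
  choose! s hs using hspan
  have hs : ∀ m ∈ M, TrigSelection.model n m = Submodule.span ℝ
      ((fun x : e => (x : EuclideanSpace ℝ (Fin n))) '' (s m : Set e)) := fun m hm => hs m (hM m hm)
  set f := TrigSelection.signal n F with hf
  set θ : e → ℝ := fun k => inner ℝ (k : EuclideanSpace ℝ (Fin n)) f with hθ
  set x : e → Ω → ℝ := fun k ω => inner ℝ (k : EuclideanSpace ℝ (Fin n)) (TrigSelection.noise ξ ω)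
    with hx
  set r : ℝ := ‖f‖ ^ 2 - ∑ k, θ k ^ 2 with hr
  have hr0 : 0 ≤ r := by
    have := hon.sum_inner_products_le f (s := Finset.univ)
    simp only [Real.norm_eq_abs, sq_abs] at this
    exact sub_nonneg.2 this
  have hobs : ∀ ω, TrigSelection.obs F ξ ω = f + TrigSelection.noise ξ ω := fun ω => rfl
  have hloss : ∀ m ∈ M, ∀ ω, ‖f - TrigSelection.lse m (TrigSelection.obs F ξ ω)‖ ^ 2 =
      TrigSelection.bias r θ (s m) + TrigSelection.energy (fun k => x k ω) (s m) :=
    fun m hm ω => by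
      simp only [TrigSelection.lse, hs m hm]
      exact TrigSelection.norm_sub_starProjection_sq hon (s m) f _
  have hcrit : ∀ m ∈ M, ∀ ω, TrigSelection.crit pen (TrigSelection.obs F ξ ω) m =
      ‖TrigSelection.obs F ξ ω‖ ^ 2 - ∑ k ∈ s m, (θ k + x k ω) ^ 2 + pen m := fun m hm ω => by
    simp only [TrigSelection.crit, TrigSelection.lse, hs m hm]
    rw [TrigSelection.norm_self_sub_starProjection_sq hon]
    simp only [hobs, inner_add_right, hθ, hx]
  have hdim : ∀ m ∈ M, TrigSelection.modelDim n m = (s m).card := fun m hm => by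
    rw [TrigSelection.modelDim, hs m hm, TrigSelection.finrank_span_image hon]
  have hx2 := fun k : e => TrigSelection.integral_inner_noise_sq_le hξ_meas hξ_indep hξ_bernstein
    hσ hc (hon.1 k)
  have hx1 := fun k : e => TrigSelection.integral_inner_noise (P := P)
    (fun i => TrigSelection.integrable_of_bernstein (hξ_meas i) hσ hc (hξ_bernstein i))
    hξ_centered (k : EuclideanSpace ℝ (Fin n))
  obtain ⟨hvσ, -⟩ := TrigSelection.varFactor_ge hσ hc ha hb
  have hLm : ∀ m, Integrable (fun ω => TrigSelection.bias r θ (s m) +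
      TrigSelection.energy (fun k => x k ω) (s m)) P := fun m =>
    (integrable_const _).add (TrigSelection.integrable_energy (fun k => (hx2 k).1) _)
  have hLhat : Integrable (fun ω => TrigSelection.bias r θ (s (mhat ω)) +
      TrigSelection.energy (fun k => x k ω) (s (mhat ω))) P := by
    -- The selected loss is a finite sum over `M` of model losses restricted to the measurable
    -- events where that model is selected.
    have h := integrable_finsetSum M fun m _ => (hLm m).indicator (hmhat_meas m)
    refine h.congr (ae_of_all _ fun ω => ?_)
    simp only [Set.indicator_apply, Set.mem_ofPred_eq]
    rw [Finset.sum_ite_eq M (mhat ω), if_pos (hmhat_mem ω)]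
  obtain ⟨T, hTi, hT0, hT, hTR⟩ := TrigSelection.exists_excess (P := P) (M := M) (s := s) hn hσ hc
    hξ_meas hξ_indep hξ_bernstein hon (fun k i => he k k.2 i) (by simpa using hcN)
    (by simpa using hcn) hΔ ha hb hD
  have hkappa : TrigSelection.kappa ^ 2 = 324 := by norm_num [TrigSelection.kappa]
  have horacle := fun m (hm : m ∈ M) => TrigSelection.integral_loss_le (M := M) (s := s) (r := r)
    (θ := θ) (Δ := Δ) (pen := pen) (mhat := mhat) (x := x) hr0 (le_trans (sq_nonneg σ) hvσ) hK
    (fun k => (hx1 k).1) (fun k => (hx1 k).2) (fun k => (hx2 k).1)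
    (fun k => (hx2 k).2.trans (by linarith)) hΔ
    (fun m hm => by rw [← hdim m hm, ← hkappa, ← mul_assoc]; exact hpen m hm) hTi hT0 hT hmhat_mem
    (fun ω m hm => by
      have := hmhat_min ω m hm
      rw [hcrit m hm, hcrit _ (hmhat_mem ω)] at this
      linarith) hLhat hm
  have hriskhat : ∀ ω, ‖f - TrigSelection.lse (mhat ω) (TrigSelection.obs F ξ ω)‖ ^ 2 = _ :=
    fun ω => hloss (mhat ω) (hmhat_mem ω) ω
  refine ⟨fun m hm => ?_, ?_, ?_⟩
  · simp only [hloss m hm]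
    exact hLm m
  · simp only [hriskhat]
    exact hLhat
  · simp only [hriskhat]
    have hC := TrigSelection.oracleConst_pos hK
    obtain ⟨ω₀⟩ := P.nonempty_of_neZero
    have : Nonempty {m : Finset ℕ // m ∈ M} := ⟨⟨mhat ω₀, hmhat_mem ω₀⟩⟩
    rw [← div_le_iff₀' hC, ← sub_le_iff_le_add]
    refine le_ciInf fun m => ?_
    rw [sub_le_iff_le_add, div_le_iff₀' hC]
    refine (horacle m.1 m.2).trans (mul_le_mul_of_nonneg_left ?_ hC.le)
    -- The coordinate inequality involves only the bias of the competitor, which is at most its risk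
    -- since the noise energy is nonnegative.
    have hbias : TrigSelection.bias r θ (s m.1) ≤
        ∫ ω, ‖f - TrigSelection.lse m.1 (TrigSelection.obs F ξ ω)‖ ^ 2 ∂P := by
      simp only [hloss m.1 m.2]
      have h1 : ∫ _ω, TrigSelection.bias r θ (s m.1) ∂P = TrigSelection.bias r θ (s m.1) := by simp
      refine h1.symm.le.trans ?_
      exact integral_mono (integrable_const _) (hLm m.1) fun ω =>
        le_add_of_nonneg_right (TrigSelection.energy_nonneg _ _)
    have hrem : 15 * ∫ ω, T ω ∂P ≤ TrigSelection.remainder n D M Δ σ c a b := by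
      rw [TrigSelection.remainder, hkappa]
      exact hTR
    linarith
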